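/- Let $\Delta=\{1,2,\dots,27,\infty\}$, ordered by $1<2<\dots<27<\infty$, and let $\mathfrak r=\mathbb C^{28}$ with standard basis $(a_i)_{i\in\Delta}$. For $I=\{i_1<\dots<i_{14}\}\subset\Delta$ put $a_I=a_{i_1}\wedge\cdots\wedge a_{i_{14}}\in\bigwedge^{14}(\mathfrak r)$. The group $\mathrm{GL}(\mathfrak r)$ acts naturally on $\bigwedge^{14}(\mathfrak r)$. A permutation $\sigma$ of $\Delta$ acts on $\mathfrak r$ by $a_i\mapsto a_{\sigma(i)}$. Let $M\subset \mathrm{GL}(\mathfrak r)$ be the (finite, monomial, of shape $2^7.G_2(2)$) group generated by the following transformations. (a) The scalar $-1$, and the sign changes $\epsilon_D$ (with $\epsilon_D a_i=-a_i$ for $i\in D$ and $\epsilon_D a_i=a_i$ for $i\notin D$) for the six sets $D$: $$\{1,4,7,10,13,14,15,16,19,22,25,\infty\},$$ $$\{2,5,8,11,13,14,15,17,20,23,26,\infty\},$$ $$\{1,3,7,8,11,12,17,18,19,20,25,27\},$$ $$\{1,2,8,9,10,12,16,18,20,21,25,26\},$$ $$\{2,3,4,5,11,12,14,15,20,21,22,24\},$$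 $$\{1,3,5,6,10,12,13,15,19,21,22,23\}.$$ (b) The coordinate permutations $$Q=(1,2,3)(4,5,6)(7,8,9)(10,11,12)(13,14,15)(16,17,18)(19,20,21)(22,23,24)(25,26,27),$$ $$N_0=(1,19,25,7)(2,20,26,8)(3,21,27,9)(4,10,22,16)(5,11,23,17)(6,12,24,18),$$ $$F_{03}=(1,19)(4,22)(7,25)(2,21)(3,20)(5,24)(6,23)(8,27)(9,26)(11,12)(14,15)(17,18),$$ $$V=(19,11,3)(20,12,1)(21,10,2)(22,13,4)(23,14,5)(24,15,6)(25,18,8)(26,16,9)(27,17,7).$$ (c) The product $i\,N_{356}$ of the scalar $i$ and the coordinate permutation $$N_{356}=(1,22,25,4)(2,23,26,5)(3,24,27,6)(7,16,19,10)(8,17,20,11)(9,18,21,12).$$ (d) The transformation $m: a_j\mapsto s_{\mu(j)}a_{\mu(j)}$, where $$\mu=(2,5)(3,12)(4,22)(6,9)(8,17)(10,16)(11,20)(13,\infty)(14,15)(18,27)(21,24)(23,26)$$ and $(s_1,\dots,s_{27},s_\infty)=(1,i,i,1,-i,-i,1,i,i,1,-i,-i,-1,1,1,1,-i,-i,1,i,i,1,-i,-i,1,i,i,-1)$.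 For $I\subset\Delta$ with $|I|=14$ let $t_I=\sum_J\gamma_J a_J\in\bigwedge^{14}(\mathfrak r)$ be the sum of the vectors in the $M$-orbit of $a_I$: that is, the sum is over the $14$-element sets $J$, and $\gamma_J$ is the sum of the scalars $c\in\{1,i,-1,-i\}$ for which $c\,a_J$ lies in the $M$-orbit of $a_I$. (For the sets used below there is at most one such $c$ for each $J$, so that $t_I$ is the $M$-invariant vector supported on the orbit of $I$ whose coefficient at $a_I$ is $1$.) Set $$\varrho=\frac1{\sqrt{86272}}\sum_{I}\bigl(r_I\,t_I+r'_I\,t_{\Delta\setminus I}\bigr),$$ where $(I,r_I,r'_I)$ runs over the $34$ rows of the table $$\begin{array}{lll} I & r_I & r'_I\\ \hline \{3,5,6,8,11,18,19,20,21,22,25,26,27,\infty\} & 4-3i & 4+3i\\ \{2,3,4,6,7,8,10,12,13,14,17,18,21,\infty\} & -4i & 4i\\ \{2,4,5,6,7,8,9,13,14,15,16,22,23,\infty\} & -2 & 2\\ \{1,5,6,10,12,13,14,15,16,17,20,22,25,27\} & -2 & -2\\ \{1,3,9,10,11,12,18,19,20,21,24,26,27,\infty\} & -2i & 2i\\ \{1,3,7,8,9,10,12,17,19,20,21,25,27,\infty\}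 & 2i & -2i\\ \{2,3,4,5,6,13,14,15,16,17,19,21,22,25\} & -2+4i & 2+4i\\ \{1,2,4,5,7,8,9,10,11,12,13,18,21,\infty\} & 2 & 2\\ \{4,6,8,10,13,15,18,20,21,22,24,26,27,\infty\} & -i & -i\\ \{3,4,7,8,9,10,11,12,13,17,19,23,25,26\} & -i & i\\ \{1,2,3,5,6,9,12,13,15,16,20,22,24,\infty\} & i & i\\ \{1,3,5,6,7,9,11,12,13,15,20,22,24,\infty\} & 2+i & -2+i\\ \{1,3,5,6,9,12,14,15,17,19,20,22,24,\infty\} & -2-i & -2+i\\ \{1,2,5,6,7,11,13,14,15,16,20,22,24,\infty\} & 2i & 2i\\ \{1,2,3,5,7,9,11,13,14,15,16,17,19,\infty\} & -i & -i\\ \{1,4,5,8,10,12,13,20,21,22,23,25,26,27\} & -2 & -2\\ \{1,3,5,6,9,10,13,17,18,19,21,24,26,27\} & 2i & -2i\\ \{4,8,10,12,15,18,20,21,22,23,25,26,27,\infty\} & i & -i\\ \{1,3,4,5,7,8,9,11,13,14,17,19,21,27\} & 2 & 2\\ \{8,9,14,15,16,17,18,19,21,23,24,25,27,\infty\} & -3-2i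 & 3-2i\\ \{8,9,14,15,16,17,18,19,20,22,23,26,27,\infty\} & -3-i & 3-i\\ \{8,9,14,15,16,17,18,19,20,21,22,24,27,\infty\} & -2-i & 2-i\\ \{8,9,14,16,18,19,20,21,22,23,25,26,27,\infty\} & -2 & 2\\ \{9,13,14,16,17,18,19,20,21,23,24,25,27,\infty\} & -1+2i & 1+2i\\ \{9,13,14,15,16,18,19,21,22,23,25,26,27,\infty\} & 1+2i & -1+2i\\ \{9,13,14,15,16,18,19,20,21,22,23,24,26,27\} & -1+i & -1-i\\ \{8,9,13,14,15,18,19,20,23,24,25,26,27,\infty\} & -1 & -1\\ \{8,9,13,14,15,18,19,20,21,22,23,24,26,\infty\} & -1+i & 1+i\\ \{8,9,13,15,16,18,19,20,21,22,23,25,26,27\} & 1-i & -1-i\\ \{9,12,14,15,16,17,18,20,21,23,24,25,26,27\} & -1-i & -1+i\\ \{9,12,14,15,16,17,18,19,20,21,22,23,25,26\} & 1-i & 1+i\\ \{9,12,15,17,18,19,20,21,22,23,24,26,27,\infty\} & 1+i & 1-i\\ \{8,9,12,14,16,17,20,21,22,23,24,25,26,27\} & 1+3i & -1+3i\\ \{8,9,12,14,15,16,19,20,21,24,25,26,27,\infty\}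 & 2-2i & -2-2i\\ \end{array}$$ Then the subgroup $$F=\{g\in \mathrm{SL}(\mathfrak r): g\varrho=\varrho\}$$ is finite. -/

import Mathlib

noncomputable section

namespace Rudvalis

/-- The index set `Δ = {1, …, 27, ∞}` is realised as `Fin 28`, with its usual order: the element
labelled `k` (`1 ≤ k ≤ 27`) is `k - 1`, and `∞` is the last element.  `pt k` is the element labelled
`k`, where `28` is used as the label of `∞`. -/
def pt (k : ℕ) : Fin 28 := Fin.ofNat 28 (k + 27)

/-- The set of elements of `Δ` with the given labels. -/
def ptSet (l : List ℕ) : Finset (Fin 28) := (l.map pt).toFinset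

/-- The permutation of `Δ` given as a product of cycles (written with labels). -/
def ofCycles (cs : List (List ℕ)) : Equiv.Perm (Fin 28) :=
  (cs.map fun c => (c.map pt).formPerm).prod

/-- The `28`-dimensional space `𝔯`, with its standard basis `(a_i)` indexed by `Δ`. -/
abbrev R28 : Type := Fin 28 → ℂ

/-- The monomial transformation `a_i ↦ i ^ (k (σ i)) • a_{σ i}` of `𝔯`: first the coordinate
permutation `σ`, then multiplication of the `j`-th coordinate by the `k j`-th power of the
imaginary unit. -/
def monomial (k : Fin 28 → ℕ) (σ : Equiv.Perm (Fin 28)) : R28 ≃ₗ[ℂ] R28 where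
  toFun v j := Complex.I ^ k j * v (σ.symm j)
  invFun v j := (Complex.I ^ k (σ j))⁻¹ * v (σ j)
  map_add' v w := by funext j; simp [mul_add]
  map_smul' c v := by funext j; simp only [Pi.smul_apply, smul_eq_mul, RingHom.id_apply]; ring
  left_inv v := by funext j; simp
  right_inv v := by funext j; simp

/-- The sign change `ε_D`: it negates `a_i` for `i ∈ D` and fixes the other `a_i`. -/
def signChange (D : Finset (Fin 28)) : R28 ≃ₗ[ℂ] R28 :=
  monomial (fun j => if j ∈ D then 2 else 0) 1

/-- The coordinate permutation `a_i ↦ a_{σ i}`. -/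
def coordPerm (σ : Equiv.Perm (Fin 28)) : R28 ≃ₗ[ℂ] R28 :=
  monomial (fun _ => 0) σ

/-- Six dozens in `Δ` which, together with `Δ` itself, span the code of dozens. -/
def dozens : List (Finset (Fin 28)) :=
  [ptSet [1, 4, 7, 10, 13, 14, 15, 16, 19, 22, 25, 28],
   ptSet [2, 5, 8, 11, 13, 14, 15, 17, 20, 23, 26, 28],
   ptSet [1, 3, 7, 8, 11, 12, 17, 18, 19, 20, 25, 27],
   ptSet [1, 2, 8, 9, 10, 12, 16, 18, 20, 21, 25, 26],
   ptSet [2, 3, 4, 5, 11, 12, 14, 15, 20, 21, 22, 24],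
   ptSet [1, 3, 5, 6, 10, 12, 13, 15, 19, 21, 22, 23]]

def permQ : Equiv.Perm (Fin 28) :=
  ofCycles [[1, 2, 3], [4, 5, 6], [7, 8, 9], [10, 11, 12], [13, 14, 15], [16, 17, 18],
    [19, 20, 21], [22, 23, 24], [25, 26, 27]]

def permN0 : Equiv.Perm (Fin 28) :=
  ofCycles [[1, 19, 25, 7], [2, 20, 26, 8], [3, 21, 27, 9],
    [4, 10, 22, 16], [5, 11, 23, 17], [6, 12, 24, 18]]

def permN356 : Equiv.Perm (Fin 28) :=
  ofCycles [[1, 22, 25, 4], [2, 23, 26, 5], [3, 24, 27, 6],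
    [7, 16, 19, 10], [8, 17, 20, 11], [9, 18, 21, 12]]

def permF03 : Equiv.Perm (Fin 28) :=
  ofCycles [[1, 19], [4, 22], [7, 25], [2, 21], [3, 20], [5, 24],
    [6, 23], [8, 27], [9, 26], [11, 12], [14, 15], [17, 18]]

def permV : Equiv.Perm (Fin 28) :=
  ofCycles [[19, 11, 3], [20, 12, 1], [21, 10, 2], [22, 13, 4], [23, 14, 5],
    [24, 15, 6], [25, 18, 8], [26, 16, 9], [27, 17, 7]]

def permM : Equiv.Perm (Fin 28) :=
  ofCycles [[2, 5], [3, 12], [4, 22], [6, 9], [8, 17], [10, 16], [11, 20], [13, 28],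
    [14, 15], [18, 27], [21, 24], [23, 26]]

/-- The scalars of the monomial transformation `m`, as exponents of the imaginary unit. -/
def expM : Fin 28 → ℕ :=
  ![0, 1, 1, 0, 3, 3, 0, 1, 1,
    0, 3, 3, 2, 0, 0, 0, 3, 3,
    0, 1, 1, 0, 3, 3, 0, 1, 1,
    2]

/-- The monomial group `M`, of shape `2^7.G_2(2)`.  The coordinate permutation `N_{356}` enters
multiplied by the imaginary unit (without this scalar the generated group would contain the scalar
`i`, which acts as `-1` on the fourteenth exterior power). -/
def monomialGroup : Subgroup (R28 ≃ₗ[ℂ] R28) :=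
  Subgroup.closure
    ({g | ∃ D ∈ dozens, g = signChange D} ∪
      {signChange Finset.univ, coordPerm permQ, coordPerm permN0,
        monomial (fun _ => 1) permN356, coordPerm permF03, coordPerm permV,
        monomial expM permM})

/-- The space `⋀¹⁴(𝔯)`. -/
abbrev Ext14 : Type := ⋀[ℂ]^14 R28

/-- The basis vector `a_I = a_{i₁} ∧ ⋯ ∧ a_{i₁₄}` of `⋀¹⁴(𝔯)`, for
`I = {i₁ < ⋯ < i₁₄} ⊆ Δ`. -/
def wedge (I : Set.powersetCard (Fin 28) 14) : Ext14 :=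
  exteriorPower.ιMulti_family ℂ 14 (fun i : Fin 28 => (Pi.single i 1 : R28)) I

/-- The orbit of `a_I` under the monomial group. -/
def wedgeOrbit (I : Set.powersetCard (Fin 28) 14) : Set Ext14 :=
  {v | ∃ g ∈ monomialGroup, v = exteriorPower.map 14 (g : R28 →ₗ[ℂ] R28) (wedge I)}

open Classical in
/-- The coefficient `γ_J`, normalised by `γ_I = 1`: the scalar `c` for which `c a_J` lies in the
orbit of `a_I` under the monomial group, and `0` if there is none.  As the matrices in the monomial
group have their nonzero entries in `{1, i, -1, -i}`, only these values of `c` occur. -/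
def gam (I J : Set.powersetCard (Fin 28) 14) : ℂ :=
  ∑ k : Fin 4, if Complex.I ^ (k : ℕ) • wedge J ∈ wedgeOrbit I then Complex.I ^ (k : ℕ) else 0

/-- The invariant `t_𝒪 = ∑_{J ∈ 𝒪} γ_J a_J` of the monomial group, where `𝒪` is the orbit of `I`
under coordinate permutations from the monomial group and `γ_I = 1`; equivalently, the sum of the
vectors in the orbit of `a_I` under the monomial group. -/
def orbitInvariant (I : Set.powersetCard (Fin 28) 14) : Ext14 :=
  ∑ J : Set.powersetCard (Fin 28) 14, gam I J • wedge J

/-- The table of orbit representatives `I` (by labels, `28` standing for `∞`), each followed by the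
coefficients `r_𝒪` and `r_𝒪'` of the invariants attached to `I` and to its complement; the Gaussian
integer `⟨x, y⟩` is `x + y i`. -/
def rhoTable : Fin 34 → List ℕ × GaussianInt × GaussianInt := ![
  ([3, 5, 6, 8, 11, 18, 19, 20, 21, 22, 25, 26, 27, 28], ⟨4, -3⟩, ⟨4, 3⟩),
  ([2, 3, 4, 6, 7, 8, 10, 12, 13, 14, 17, 18, 21, 28], ⟨0, -4⟩, ⟨0, 4⟩),
  ([2, 4, 5, 6, 7, 8, 9, 13, 14, 15, 16, 22, 23, 28], ⟨-2, 0⟩, ⟨2, 0⟩),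
  ([1, 5, 6, 10, 12, 13, 14, 15, 16, 17, 20, 22, 25, 27], ⟨-2, 0⟩, ⟨-2, 0⟩),
  ([1, 3, 9, 10, 11, 12, 18, 19, 20, 21, 24, 26, 27, 28], ⟨0, -2⟩, ⟨0, 2⟩),
  ([1, 3, 7, 8, 9, 10, 12, 17, 19, 20, 21, 25, 27, 28], ⟨0, 2⟩, ⟨0, -2⟩),
  ([2, 3, 4, 5, 6, 13, 14, 15, 16, 17, 19, 21, 22, 25], ⟨-2, 4⟩, ⟨2, 4⟩),
  ([1, 2, 4, 5, 7, 8, 9, 10, 11, 12, 13, 18, 21, 28], ⟨2, 0⟩, ⟨2, 0⟩),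
  ([4, 6, 8, 10, 13, 15, 18, 20, 21, 22, 24, 26, 27, 28], ⟨0, -1⟩, ⟨0, -1⟩),
  ([3, 4, 7, 8, 9, 10, 11, 12, 13, 17, 19, 23, 25, 26], ⟨0, -1⟩, ⟨0, 1⟩),
  ([1, 2, 3, 5, 6, 9, 12, 13, 15, 16, 20, 22, 24, 28], ⟨0, 1⟩, ⟨0, 1⟩),
  ([1, 3, 5, 6, 7, 9, 11, 12, 13, 15, 20, 22, 24, 28], ⟨2, 1⟩, ⟨-2, 1⟩),
  ([1, 3, 5, 6, 9, 12, 14, 15, 17, 19, 20, 22, 24, 28], ⟨-2, -1⟩, ⟨-2, 1⟩),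
  ([1, 2, 5, 6, 7, 11, 13, 14, 15, 16, 20, 22, 24, 28], ⟨0, 2⟩, ⟨0, 2⟩),
  ([1, 2, 3, 5, 7, 9, 11, 13, 14, 15, 16, 17, 19, 28], ⟨0, -1⟩, ⟨0, -1⟩),
  ([1, 4, 5, 8, 10, 12, 13, 20, 21, 22, 23, 25, 26, 27], ⟨-2, 0⟩, ⟨-2, 0⟩),
  ([1, 3, 5, 6, 9, 10, 13, 17, 18, 19, 21, 24, 26, 27], ⟨0, 2⟩, ⟨0, -2⟩),
  ([4, 8, 10, 12, 15, 18, 20, 21, 22, 23, 25, 26, 27, 28], ⟨0, 1⟩, ⟨0, -1⟩),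
  ([1, 3, 4, 5, 7, 8, 9, 11, 13, 14, 17, 19, 21, 27], ⟨2, 0⟩, ⟨2, 0⟩),
  ([8, 9, 14, 15, 16, 17, 18, 19, 21, 23, 24, 25, 27, 28], ⟨-3, -2⟩, ⟨3, -2⟩),
  ([8, 9, 14, 15, 16, 17, 18, 19, 20, 22, 23, 26, 27, 28], ⟨-3, -1⟩, ⟨3, -1⟩),
  ([8, 9, 14, 15, 16, 17, 18, 19, 20, 21, 22, 24, 27, 28], ⟨-2, -1⟩, ⟨2, -1⟩),
  ([8, 9, 14, 16, 18, 19, 20, 21, 22, 23, 25, 26, 27, 28], ⟨-2, 0⟩, ⟨2, 0⟩),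
  ([9, 13, 14, 16, 17, 18, 19, 20, 21, 23, 24, 25, 27, 28], ⟨-1, 2⟩, ⟨1, 2⟩),
  ([9, 13, 14, 15, 16, 18, 19, 21, 22, 23, 25, 26, 27, 28], ⟨1, 2⟩, ⟨-1, 2⟩),
  ([9, 13, 14, 15, 16, 18, 19, 20, 21, 22, 23, 24, 26, 27], ⟨-1, 1⟩, ⟨-1, -1⟩),
  ([8, 9, 13, 14, 15, 18, 19, 20, 23, 24, 25, 26, 27, 28], ⟨-1, 0⟩, ⟨-1, 0⟩),
  ([8, 9, 13, 14, 15, 18, 19, 20, 21, 22, 23, 24, 26, 28], ⟨-1, 1⟩, ⟨1, 1⟩),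
  ([8, 9, 13, 15, 16, 18, 19, 20, 21, 22, 23, 25, 26, 27], ⟨1, -1⟩, ⟨-1, -1⟩),
  ([9, 12, 14, 15, 16, 17, 18, 20, 21, 23, 24, 25, 26, 27], ⟨-1, -1⟩, ⟨-1, 1⟩),
  ([9, 12, 14, 15, 16, 17, 18, 19, 20, 21, 22, 23, 25, 26], ⟨1, -1⟩, ⟨1, 1⟩),
  ([9, 12, 15, 17, 18, 19, 20, 21, 22, 23, 24, 26, 27, 28], ⟨1, 1⟩, ⟨1, -1⟩),
  ([8, 9, 12, 14, 16, 17, 20, 21, 22, 23, 24, 25, 26, 27], ⟨1, 3⟩, ⟨-1, 3⟩),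
  ([8, 9, 12, 14, 15, 16, 19, 20, 21, 24, 25, 26, 27, 28], ⟨2, -2⟩, ⟨-2, -2⟩)]

theorem card_rhoTable (k : Fin 34) : ptSet (rhoTable k).1 ∈ Set.powersetCard (Fin 28) 14 := by
  rw [Set.powersetCard.mem_iff]
  revert k
  decide

/-- The `k`-th representative `I`. -/
def rep (k : Fin 34) : Set.powersetCard (Fin 28) 14 := ⟨ptSet (rhoTable k).1, card_rhoTable k⟩

/-- The complement `I' = Δ \ I` of the `k`-th representative. -/
def repCompl (k : Fin 34) : Set.powersetCard (Fin 28) 14 :=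
  Set.powersetCard.compl (by simp) (rep k)

/-- The vector `ϱ ∈ ⋀¹⁴(𝔯)`. -/
def rho : Ext14 :=
  (1 / (Real.sqrt 86272 : ℂ)) •
    ∑ k : Fin 34,
      (((rhoTable k).2.1 : ℂ) • orbitInvariant (rep k) +
        ((rhoTable k).2.2 : ℂ) • orbitInvariant (repCompl k))

/-- The subgroup `F` of `SL(𝔯)` consisting of the `g` whose natural action on `⋀¹⁴(𝔯)` fixes
`ϱ`. -/
def groupF : Subgroup (SpecialLinearGroup ℂ R28) where
  carrier := {g | exteriorPower.map 14 (g.toLinearEquiv : R28 →ₗ[ℂ] R28) rho = rho}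
  one_mem' := by
    change exteriorPower.map 14 LinearMap.id rho = rho
    rw [exteriorPower.map_id, LinearMap.id_apply]
  mul_mem' {g h} hg hh := by
    change exteriorPower.map 14
      ((g.toLinearEquiv : R28 →ₗ[ℂ] R28) ∘ₗ (h.toLinearEquiv : R28 →ₗ[ℂ] R28)) rho = rho
    rw [exteriorPower.map_comp, LinearMap.comp_apply, hh, hg]
  inv_mem' {g} hg := by
    change exteriorPower.map 14 (g⁻¹.toLinearEquiv : R28 →ₗ[ℂ] R28) rho = rho
    have key : (g⁻¹.toLinearEquiv : R28 →ₗ[ℂ] R28) ∘ₗ (g.toLinearEquiv : R28 →ₗ[ℂ] R28)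
        = LinearMap.id := by
      have h1 : g⁻¹.toLinearEquiv * g.toLinearEquiv = 1 := by
        rw [← map_mul, inv_mul_cancel, map_one]
      exact congrArg (fun e : R28 ≃ₗ[ℂ] R28 => (e : R28 →ₗ[ℂ] R28)) h1
    nth_rewrite 1 [← hg]
    rw [← LinearMap.comp_apply, ← exteriorPower.map_comp, key, exteriorPower.map_id,
      LinearMap.id_apply]

end Rudvalis

end

/-! The argument has a general half and a half special to `ϱ`.

The general half, `finite_stabilizer_of_critical`, is of Kempf–Ness type. Let `v` lie in an exterior
power of `ℂ^ι`, with `⟨v, Xv⟩ = 0` for every traceless `X` (criticality) and `Xv = 0` only for `X =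
0`, where `X` acts as a derivation. If `det A = 1` and `Av = v`, write `A*A = U diag(e^x) U*`, `w =
U*v` and `x_K = ∑_{i ∈ K} x_i`. Criticality gives `∑ |w_K|² x_K = 0`, and `⟨v, A*Av⟩ = ⟨v, v⟩` gives
`∑ |w_K|² e^{x_K} = ∑ |w_K|²`. Since `e^t ≥ 1 + t` with equality only at `0`, `x_K = 0` wherever
`w_K ≠ 0`. So `diag(x)` kills `w`, hence `x = 0` and `A` is unitary. The stabiliser is thus compact;
it is discrete because `A ↦ Av` has injective derivative at `1`; hence it is finite.

For `ϱ`, both hypotheses come from invariance under the monomial group `M`. The functional `X ↦ ⟨ϱ,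
Xϱ⟩` is `M`-invariant: sign changes kill its off-diagonal part and transitivity equates its diagonal
values, so it is a multiple of the trace (`der_rho_eq_zero`).

Now let `Xϱ = 0`. Since `M` is doubly transitive on `Δ`, the off-diagonal part of every such `X`
vanishes once the one entry at `(19, ∞)` always does (positions `18` and `27` when counting from
zero). Let `I` be the second representative and look at the coordinate of `Xϱ` at `(I \ {∞}) ∪
{19}`. Only sets differing from this one in at most one element contribute, and parity against the
dozens leaves just `I` and `evenNeighbour`. The coefficient of the latter is zero, since an element
of `M` negates its basis vector. What remains is the entry times the coefficient of `ϱ` at `I`, up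
to sign. Diagonal `X` are excluded by summing over 27 permutations
(`diagonal_eq_zero_of_annihilates`).

It remains that the coefficient at `I` is nonzero (`coeffRho_rep`). The orbit of `a_I` lies in an
explicit `M`-stable table of 3024 vectors, which avoids the other 67 sets in the definition of `ϱ`
and contains no multiple of `a_I` but `a_I` itself. So the coefficient is `-4i / √86272`. -/

open Module

noncomputable section

/-! ### Matrices acting on exterior powers, and the Hermitian form. -/

section ExteriorAction

open scoped ComplexOrder

variable {ι : Type*} [Fintype ι] [LinearOrder ι] {n : ℕ}

/-- The action of a matrix on an exterior power of the coordinate space. -/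
def extAct (n : ℕ) (A : Matrix ι ι ℂ) : ⋀[ℂ]^n (ι → ℂ) →ₗ[ℂ] ⋀[ℂ]^n (ι → ℂ) :=
  exteriorPower.map n (Matrix.toLin' A)

/-- The standard basis of an exterior power of the coordinate space. -/
def extBasis (ι : Type*) [Fintype ι] [LinearOrder ι] (n : ℕ) :
    Basis (Set.powersetCard ι n) ℂ (⋀[ℂ]^n (ι → ℂ)) :=
  (Pi.basisFun ℂ ι).exteriorPower n

/-- The increasing enumeration of an `n`-element set. -/
abbrev enum (K : Set.powersetCard ι n) : Fin n ↪o ι := Set.powersetCard.ofFinEmbEquiv.symm K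

lemma extBasis_apply (K : Set.powersetCard ι n) :
    extBasis ι n K = exteriorPower.ιMulti ℂ n (fun p => (Pi.single (enum K p) 1 : ι → ℂ)) := by
  rw [extBasis, exteriorPower.basis_apply, exteriorPower.ιMulti_family]
  congr 1
  funext p
  simp

lemma extBasis_repr_ιMulti (v : Fin n → ι → ℂ) (J : Set.powersetCard ι n) :
    (extBasis ι n).repr (exteriorPower.ιMulti ℂ n v) J
      = (Matrix.of fun p q => v p (enum J q)).det := by
  rw [extBasis, exteriorPower.basis_repr_apply, exteriorPower.ιMultiDual_apply_ιMulti]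
  simp

lemma extAct_one : extAct (ι := ι) n 1 = LinearMap.id := by
  rw [extAct, Matrix.toLin'_one, exteriorPower.map_id]

lemma extAct_mul (A B : Matrix ι ι ℂ) : extAct n (A * B) = extAct n A ∘ₗ extAct n B := by
  rw [extAct, Matrix.toLin'_mul, exteriorPower.map_comp]; rfl

lemma extAct_mul_apply (A B : Matrix ι ι ℂ) (v : ⋀[ℂ]^n (ι → ℂ)) :
    extAct n (A * B) v = extAct n A (extAct n B v) := by
  rw [extAct_mul]; rfl

lemma extAct_extBasis (A : Matrix ι ι ℂ) (K : Set.powersetCard ι n) :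
    extAct n A (extBasis ι n K)
      = exteriorPower.ιMulti ℂ n (fun p i => A i (enum K p)) := by
  rw [extBasis_apply, extAct, exteriorPower.map_apply_ιMulti]
  congr 1
  funext p
  simp only [Function.comp_apply, Matrix.toLin'_apply, Matrix.mulVec_single_one]
  rfl

lemma extBasis_repr_extAct (A : Matrix ι ι ℂ) (J K : Set.powersetCard ι n) :
    (extBasis ι n).repr (extAct n A (extBasis ι n K)) J
      = (A.submatrix (enum J) (enum K)).det := by
  rw [extAct_extBasis, extBasis_repr_ιMulti, ← Matrix.det_transpose]
  rfl

/-- The standard Hermitian form on an exterior power of the coordinate space. -/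
def extInner (u v : ⋀[ℂ]^n (ι → ℂ)) : ℂ :=
  ∑ J, starRingEnd ℂ ((extBasis ι n).repr u J) * (extBasis ι n).repr v J

lemma repr_extAct_apply (A : Matrix ι ι ℂ) (v : ⋀[ℂ]^n (ι → ℂ)) (J : Set.powersetCard ι n) :
    (extBasis ι n).repr (extAct n A v) J
      = ∑ K, (extBasis ι n).repr v K * (A.submatrix (enum J) (enum K)).det := by
  conv_lhs => rw [← (extBasis ι n).sum_repr v]
  simp only [map_sum, map_smul, Finsupp.finsetSum_apply, Finsupp.smul_apply, smul_eq_mul,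
    extBasis_repr_extAct]

/-- In the standard basis the entries of the action are minors, and the minors of the conjugate
transpose are the conjugates of the transposed minors. -/
lemma extInner_extAct (A : Matrix ι ι ℂ) (u v : ⋀[ℂ]^n (ι → ℂ)) :
    extInner (extAct n A u) v = extInner u (extAct n A.conjTranspose v) := by
  simp only [extInner, repr_extAct_apply, map_sum, map_mul, Finset.sum_mul, Finset.mul_sum]
  rw [Finset.sum_comm]
  refine Finset.sum_congr rfl fun K _ => Finset.sum_congr rfl fun J _ => ?_
  have : (A.conjTranspose.submatrix (enum K) (enum J)).det
      = starRingEnd ℂ (A.submatrix (enum J) (enum K)).det := by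
    rw [← Matrix.conjTranspose_submatrix, Matrix.det_conjTranspose]; rfl
  rw [this]; ring

lemma extInner_self_eq (u : ⋀[ℂ]^n (ι → ℂ)) :
    extInner u u = ((∑ J, ‖(extBasis ι n).repr u J‖ ^ 2 : ℝ) : ℂ) := by
  simp [extInner, Complex.conj_mul']

lemma extAct_diagonal (d : ι → ℂ) (K : Set.powersetCard ι n) :
    extAct n (Matrix.diagonal d) (extBasis ι n K)
      = (∏ p, d (enum K p)) • extBasis ι n K := by
  rw [extAct_extBasis, extBasis_apply, ← AlternatingMap.map_smul_univ]
  congr 1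
  funext p i
  by_cases h : i = enum K p
  · subst h; simp
  · simp [h, Matrix.diagonal_apply_ne]

lemma repr_extAct_diagonal (d : ι → ℂ) (v : ⋀[ℂ]^n (ι → ℂ)) (K : Set.powersetCard ι n) :
    (extBasis ι n).repr (extAct n (Matrix.diagonal d) v) K
      = (∏ p, d (enum K p)) * (extBasis ι n).repr v K := by
  conv_lhs => rw [← (extBasis ι n).sum_repr v]
  simp only [map_sum, map_smul, extAct_diagonal, Basis.repr_self, Finsupp.finsetSum_apply,
    Finsupp.smul_single, smul_eq_mul, Finsupp.single_apply]
  simp [Finset.sum_ite_eq', mul_comm]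

-- The infinitesimal action, as a derivative at the identity.

attribute [local instance] Matrix.normedAddCommGroup Matrix.normedSpace

/-- The linear functional `X ↦ ∑ p, ψ (e_{k₁} ∧ ⋯ ∧ X e_{k_p} ∧ ⋯ ∧ e_{k_n})`. -/
def derBasis (K : Set.powersetCard ι n) (ψ : ⋀[ℂ]^n (ι → ℂ) →ₗ[ℂ] ℂ) :
    Matrix ι ι ℂ →ₗ[ℂ] ℂ where
  toFun X := ∑ p, ψ (exteriorPower.ιMulti ℂ n
    (Function.update (fun p => (Pi.single (enum K p) 1 : ι → ℂ)) p (fun i => X i (enum K p))))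
  map_add' X Y := by
    rw [← Finset.sum_add_distrib]
    refine Finset.sum_congr rfl fun p _ => ?_
    rw [← map_add, ← AlternatingMap.map_update_add]; rfl
  map_smul' c X := by
    rw [RingHom.id_apply, Finset.smul_sum]
    refine Finset.sum_congr rfl fun p _ => ?_
    rw [← map_smul, ← AlternatingMap.map_update_smul]; rfl

lemma derBasis_apply {ι : Type*} [LinearOrder ι] {n : ℕ} (K : Set.powersetCard ι n)
    (ψ : ⋀[ℂ]^n (ι → ℂ) →ₗ[ℂ] ℂ) (X : Matrix ι ι ℂ) : derBasis K ψ X = ∑ p, ψ (exteriorPower.ιMulti ℂ n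
      (Function.update (fun p => (Pi.single (enum K p) 1 : ι → ℂ)) p
        (fun i => X i (enum K p)))) := rfl

/-- The derivative at the identity of `A ↦ ψ (A v)`. -/
def der (v : ⋀[ℂ]^n (ι → ℂ)) (ψ : ⋀[ℂ]^n (ι → ℂ) →ₗ[ℂ] ℂ) : Matrix ι ι ℂ →ₗ[ℂ] ℂ :=
  ∑ K, (extBasis ι n).repr v K • derBasis K ψ

/-- The coordinates are minors, hence polynomials. Continuity is what allows the exterior product to
be bundled as a continuous multilinear map and differentiated. -/
lemma continuous_apply_ιMulti (ψ : ⋀[ℂ]^n (ι → ℂ) →ₗ[ℂ] ℂ) :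
    Continuous fun v : Fin n → ι → ℂ => ψ (exteriorPower.ιMulti ℂ n v) := by
  have h : (fun v : Fin n → ι → ℂ => ψ (exteriorPower.ιMulti ℂ n v)) = fun v =>
      ∑ J, (Matrix.of fun p q => v p (enum J q)).det * ψ (extBasis ι n J) := by
    funext v
    conv_lhs => rw [← (extBasis ι n).sum_repr (exteriorPower.ιMulti ℂ n v)]
    simp only [map_sum, map_smul, smul_eq_mul, extBasis_repr_ιMulti]
  rw [h]
  refine continuous_finsetSum _ fun J _ => (Continuous.matrix_det ?_).mul continuous_const
  refine continuous_matrix fun p q => ?_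
  exact (continuous_apply (enum J q)).comp (continuous_apply p)

/-- `A` enters only through its columns indexed by `K`, so the function is a multilinear map after a
linear one, and the derivative is given by the Leibniz rule. -/
lemma hasFDerivAt_extAct_extBasis (K : Set.powersetCard ι n) (ψ : ⋀[ℂ]^n (ι → ℂ) →ₗ[ℂ] ℂ) :
    HasFDerivAt (fun A : Matrix ι ι ℂ => ψ (extAct n A (extBasis ι n K)))
      (derBasis K ψ).toContinuousLinearMap 1 := by
  let f : ContinuousMultilinearMap ℂ (fun _ : Fin n => ι → ℂ) ℂ :=
    ⟨(ψ.compAlternatingMap (exteriorPower.ιMulti ℂ n)).toMultilinearMap,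
      continuous_apply_ιMulti ψ⟩
  let g : Matrix ι ι ℂ →ₗ[ℂ] (Fin n → ι → ℂ) :=
    { toFun := fun A p i => A i (enum K p)
      map_add' := fun _ _ => rfl
      map_smul' := fun _ _ => rfl }
  have h := (f.hasFDerivAt (g.toContinuousLinearMap 1)).comp (1 : Matrix ι ι ℂ)
    g.toContinuousLinearMap.hasFDerivAt
  have hf : (fun A : Matrix ι ι ℂ => ψ (extAct n A (extBasis ι n K)))
      = f ∘ g.toContinuousLinearMap := by
    funext A
    rw [extAct_extBasis]; rfl
  rw [hf]
  refine h.congr_fderiv ?_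
  have hg : (g.toContinuousLinearMap 1) = fun p => (Pi.single (enum K p) 1 : ι → ℂ) := by
    funext p i
    change (1 : Matrix ι ι ℂ) i (enum K p) = _
    rw [Matrix.one_apply, Pi.single_apply]
  ext X
  change f.linearDeriv (g.toContinuousLinearMap 1) (g X) = _
  rw [hg, ContinuousMultilinearMap.linearDeriv_apply]
  rfl

lemma hasFDerivAt_extAct (v : ⋀[ℂ]^n (ι → ℂ)) (ψ : ⋀[ℂ]^n (ι → ℂ) →ₗ[ℂ] ℂ) :
    HasFDerivAt (fun A : Matrix ι ι ℂ => ψ (extAct n A v))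
      (der v ψ).toContinuousLinearMap 1 := by
  have h : (fun A : Matrix ι ι ℂ => ψ (extAct n A v)) = fun A => ∑ K,
      (extBasis ι n).repr v K • ψ (extAct n A (extBasis ι n K)) := by
    funext A
    conv_lhs => rw [← (extBasis ι n).sum_repr v]
    simp only [map_sum, map_smul]
  rw [h]
  refine (HasFDerivAt.fun_sum fun K _ =>
    (hasFDerivAt_extAct_extBasis K ψ).const_smul ((extBasis ι n).repr v K)).congr_fderiv ?_
  ext X
  refine (sum_apply (F := Matrix ι ι ℂ →L[ℂ] ℂ) _ _ _).trans ?_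
  change ∑ K, (extBasis ι n).repr v K * derBasis K ψ X = der v ψ X
  rw [der, LinearMap.sum_apply]
  rfl

/-- Both sides are derivatives at `1` of the same function, so they agree by uniqueness. Identities
for `der` thus follow from identities for the group action, without the Leibniz formula. -/
lemma der_eq_of_forall (v w : ⋀[ℂ]^n (ι → ℂ)) (ψ φ : ⋀[ℂ]^n (ι → ℂ) →ₗ[ℂ] ℂ)
    (f : Matrix ι ι ℂ →ₗ[ℂ] Matrix ι ι ℂ) (hf : f 1 = 1)
    (h : ∀ A, ψ (extAct n (f A) v) = φ (extAct n A w)) (X : Matrix ι ι ℂ) :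
    der v ψ (f X) = der w φ X := by
  have h1 := hasFDerivAt_extAct v ψ
  rw [← hf] at h1
  have h2 := HasFDerivAt.comp (f := f.toContinuousLinearMap) (1 : Matrix ι ι ℂ) h1
    f.toContinuousLinearMap.hasFDerivAt
  have h3 := hasFDerivAt_extAct w φ
  rw [← funext h] at h3
  exact DFunLike.congr_fun (h2.unique h3) X

/-- Transport of the derivative under conjugation. -/
lemma der_conj (v : ⋀[ℂ]^n (ι → ℂ)) (ψ : ⋀[ℂ]^n (ι → ℂ) →ₗ[ℂ] ℂ) (P Q : Matrix ι ι ℂ)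
    (hPQ : P * Q = 1) (X : Matrix ι ι ℂ) :
    der v ψ (P * X * Q) = der (extAct n Q v) (ψ ∘ₗ extAct n P) X := by
  let f : Matrix ι ι ℂ →ₗ[ℂ] Matrix ι ι ℂ := LinearMap.mulLeft ℂ P ∘ₗ LinearMap.mulRight ℂ Q
  have h := der_eq_of_forall v (extAct n Q v) ψ (ψ ∘ₗ extAct n P) f (by simp [f, hPQ])
    (fun A => by
      change ψ (extAct n (P * (A * Q)) v) = ψ (extAct n P (extAct n A (extAct n Q v)))
      rw [extAct_mul_apply, extAct_mul_apply]) X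
  rw [← h, mul_assoc]; rfl

lemma derBasis_diagonal (K : Set.powersetCard ι n) (ψ : ⋀[ℂ]^n (ι → ℂ) →ₗ[ℂ] ℂ) (x : ι → ℂ) :
    derBasis K ψ (Matrix.diagonal x) = (∑ p, x (enum K p)) * ψ (extBasis ι n K) := by
  rw [Finset.sum_mul, derBasis_apply]
  refine Finset.sum_congr rfl fun p _ => ?_
  have : (fun i => Matrix.diagonal x i (enum K p)) =
      x (enum K p) • (Pi.single (enum K p) 1 : ι → ℂ) := by
    funext i
    by_cases h : i = enum K p
    · subst h; simp
    · simp [h, Matrix.diagonal_apply_ne]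
  rw [this, AlternatingMap.map_update_smul, map_smul, smul_eq_mul,
    Function.update_eq_self (f := fun p => (Pi.single (enum K p) 1 : ι → ℂ)), extBasis_apply]

lemma der_diagonal (v : ⋀[ℂ]^n (ι → ℂ)) (ψ : ⋀[ℂ]^n (ι → ℂ) →ₗ[ℂ] ℂ) (x : ι → ℂ) :
    der v ψ (Matrix.diagonal x)
      = ∑ K, (extBasis ι n).repr v K * (∑ p, x (enum K p)) * ψ (extBasis ι n K) := by
  simp [der, LinearMap.sum_apply, derBasis_diagonal, mul_assoc]

/-! ### Critical vectors: their stabilisers are unitary. -/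

/-- The matrices that annihilate `v` infinitesimally. -/
def Annihilates (X : Matrix ι ι ℂ) (v : ⋀[ℂ]^n (ι → ℂ)) : Prop := ∀ ψ, der v ψ X = 0

/-- The linear functional `extInner v`. -/
def extDual (v : ⋀[ℂ]^n (ι → ℂ)) : ⋀[ℂ]^n (ι → ℂ) →ₗ[ℂ] ℂ :=
  ∑ J, starRingEnd ℂ ((extBasis ι n).repr v J) • (extBasis ι n).coord J

lemma extDual_apply (v w : ⋀[ℂ]^n (ι → ℂ)) : extDual v w = extInner v w := by
  simp [extDual, extInner, LinearMap.sum_apply]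

lemma extDual_comp_extAct (v : ⋀[ℂ]^n (ι → ℂ)) (A : Matrix ι ι ℂ) :
    extDual v ∘ₗ extAct n A = extDual (extAct n A.conjTranspose v) := by
  refine LinearMap.ext fun w => ?_
  rw [LinearMap.comp_apply, extDual_apply, ← Matrix.conjTranspose_conjTranspose A, ← extInner_extAct,
    Matrix.conjTranspose_conjTranspose, extDual_apply]

/-- The moment functional transforms equivariantly under unitary matrices. -/
lemma der_extDual_conj (v : ⋀[ℂ]^n (ι → ℂ)) (U X : Matrix ι ι ℂ) (hU : U * U.conjTranspose = 1) :
    der v (extDual v) (U * X * U.conjTranspose)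
      = der (extAct n U.conjTranspose v) (extDual (extAct n U.conjTranspose v)) X := by
  rw [der_conj v _ U _ hU, extDual_comp_extAct]

/-- The basis vectors are weight vectors for diagonal matrices, with weight the sum of the diagonal
entries over `K`. The moment functional is therefore the average of the weights against the squared
moduli of the coordinates. -/
lemma der_extDual_diagonal (v : ⋀[ℂ]^n (ι → ℂ)) (x : ι → ℝ) :
    der v (extDual v) (Matrix.diagonal fun i => (x i : ℂ))
      = ((∑ K, ‖(extBasis ι n).repr v K‖ ^ 2 * ∑ p, x (enum K p) : ℝ) : ℂ) := by
  rw [der_diagonal, Complex.ofReal_sum]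
  refine Finset.sum_congr rfl fun K _ => ?_
  have : extDual v (extBasis ι n K) = starRingEnd ℂ ((extBasis ι n).repr v K) := by
    rw [extDual_apply]
    simp [extInner, Finsupp.single_apply]
  rw [this, mul_right_comm, Complex.mul_conj']
  push_cast; rfl

/-- A real diagonal matrix preserving the norm of a critical vector moves the vector
infinitesimally trivially. -/
lemma annihilates_diagonal_of_norm_eq (v : ⋀[ℂ]^n (ι → ℂ)) (x : ι → ℝ)
    (hcrit : der v (extDual v) (Matrix.diagonal fun i => (x i : ℂ)) = 0)
    (hnorm : extInner v (extAct n (Matrix.diagonal fun i => (Real.exp (x i) : ℂ)) v)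
      = extInner v v) :
    Annihilates (Matrix.diagonal fun i => (x i : ℂ)) v := by
  rw [der_extDual_diagonal, Complex.ofReal_eq_zero] at hcrit
  have h2 : (∑ K, ‖(extBasis ι n).repr v K‖ ^ 2 * Real.exp (∑ p, x (enum K p)))
      = ∑ K, ‖(extBasis ι n).repr v K‖ ^ 2 := by
    have : extInner v (extAct n (Matrix.diagonal fun i => (Real.exp (x i) : ℂ)) v)
        = ((∑ K, ‖(extBasis ι n).repr v K‖ ^ 2 * Real.exp (∑ p, x (enum K p)) : ℝ) : ℂ) := by
      rw [extInner, Complex.ofReal_sum]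
      refine Finset.sum_congr rfl fun K _ => ?_
      rw [repr_extAct_diagonal, mul_left_comm, Complex.conj_mul', Real.exp_sum, mul_comm]
      push_cast; rfl
    rw [this, extInner_self_eq] at hnorm
    exact_mod_cast hnorm
  -- Criticality and preservation of the norm combine into a vanishing sum of the nonnegative terms
  -- `|v_K|² (e^t - 1 - t)`. Each vanishes, so `t = 0` or `v_K = 0`.
  have h3 : ∑ K, ‖(extBasis ι n).repr v K‖ ^ 2 *
      (Real.exp (∑ p, x (enum K p)) - ((∑ p, x (enum K p)) + 1)) = 0 := by
    simp only [mul_sub, mul_add, mul_one, Finset.sum_sub_distrib, Finset.sum_add_distrib, h2, hcrit]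
    ring
  rw [Finset.sum_eq_zero_iff_of_nonneg fun K _ =>
    mul_nonneg (sq_nonneg _) (sub_nonneg.2 (Real.add_one_le_exp _))] at h3
  intro ψ
  rw [der_diagonal]
  refine Finset.sum_eq_zero fun K _ => ?_
  rcases mul_eq_zero.1 (h3 K (Finset.mem_univ _)) with h | h
  · rw [norm_eq_zero.1 (pow_eq_zero_iff two_ne_zero |>.1 h)]; simp
  · have : ∑ p, x (enum K p) = 0 := by
      by_contra h0
      exact absurd (Real.add_one_lt_exp h0) (by linarith)
    have h4 : ∑ p, (x (enum K p) : ℂ) = 0 := by exact_mod_cast this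
    rw [h4]; simp

lemma Annihilates.conj {v : ⋀[ℂ]^n (ι → ℂ)} {P Q X : Matrix ι ι ℂ} (hPQ : P * Q = 1)
    (h : Annihilates X (extAct n Q v)) : Annihilates (P * X * Q) v := fun ψ => by
  rw [der_conj v ψ P Q hPQ]; exact h _

/-- A matrix of determinant one fixing a critical vector with trivial infinitesimal stabiliser
is unitary. -/
theorem conjTranspose_mul_self_of_extAct_eq (v : ⋀[ℂ]^n (ι → ℂ))
    (hcrit : ∀ X : Matrix ι ι ℂ, X.trace = 0 → der v (extDual v) X = 0)
    (hann : ∀ X : Matrix ι ι ℂ, Annihilates X v → X = 0)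
    (A : Matrix ι ι ℂ) (hdet : A.det = 1) (hA : extAct n A v = v) :
    A.conjTranspose * A = 1 := by
  have hpos : (A.conjTranspose * A).PosDef := by
    refine Matrix.PosDef.conjTranspose_mul_self _ ?_
    exact Matrix.mulVec_injective_of_isUnit ((Matrix.isUnit_iff_isUnit_det A).2 (by simp [hdet]))
  set H := A.conjTranspose * A with hH
  let U : Matrix ι ι ℂ := hpos.1.eigenvectorUnitary
  let d := hpos.1.eigenvalues
  have hU : U * U.conjTranspose = 1 := (Matrix.mem_unitaryGroup_iff).1 hpos.1.eigenvectorUnitary.2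
  have hU' : U.conjTranspose * U = 1 := (Matrix.mem_unitaryGroup_iff').1 hpos.1.eigenvectorUnitary.2
  have hspec : H = U * Matrix.diagonal (fun i => (d i : ℂ)) * U.conjTranspose :=
    hpos.1.spectral_theorem
  have hd : ∀ i, 0 < d i := hpos.eigenvalues_pos
  let x : ι → ℝ := fun i => Real.log (d i)
  have hexp : (fun i => (Real.exp (x i) : ℂ)) = fun i => (d i : ℂ) := by
    funext i; rw [← Real.exp_log (hd i)]
  have hsum : ∑ i, x i = 0 := by
    have : ∏ i, (d i : ℂ) = 1 := by
      have h1 : H.det = 1 := by rw [hH, Matrix.det_mul, Matrix.det_conjTranspose, hdet]; simp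
      rw [← h1]; exact hpos.1.det_eq_prod_eigenvalues.symm
    have h2 : ∏ i, d i = 1 := by exact_mod_cast this
    rw [← Real.log_prod (fun i _ => (hd i).ne'), h2, Real.log_one]
  set w := extAct n U.conjTranspose v with hw
  have hdiag : Annihilates (Matrix.diagonal fun i => (x i : ℂ)) w := by
    refine annihilates_diagonal_of_norm_eq w x ?_ ?_
    · rw [hw, ← der_extDual_conj v U _ hU]
      apply hcrit
      rw [Matrix.trace_mul_comm, ← mul_assoc, hU', one_mul, Matrix.trace_diagonal]
      exact_mod_cast hsum
    -- The chain is `⟨w, diag(d) w⟩ = ⟨v, A*A v⟩ = ⟨Av, Av⟩ = ⟨v, v⟩ = ⟨w, w⟩`.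
    · rw [hexp, hw, extInner_extAct, extInner_extAct, Matrix.conjTranspose_conjTranspose,
        ← extAct_mul_apply, ← extAct_mul_apply, ← extAct_mul_apply, hU, ← hspec,
        extAct_one, hH, extAct_mul_apply, hA, LinearMap.id_apply]
      rw [← extInner_extAct, hA]
  have hX : U * Matrix.diagonal (fun i => (x i : ℂ)) * U.conjTranspose = 0 :=
    hann _ (Annihilates.conj hU hdiag)
  have hX0 : Matrix.diagonal (fun i => (x i : ℂ)) = 0 := by
    have := congrArg (fun Y => U.conjTranspose * Y * U) hX
    simpa [mul_assoc, hU', ← mul_assoc U.conjTranspose U] using this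
  have hx : ∀ i, x i = 0 := fun i => by
    have := congrFun (congrFun hX0 i) i
    simpa using this
  rw [hspec, ← hexp]
  simp [hx, hU]

/-! ### Discreteness and finiteness of the stabiliser. -/

/-- The vector `w` is `X` applied to `v` as a derivation. Its existence reduces annihilation to the
coordinate functionals, and so to finitely many equations. -/
lemma exists_der_eq (v : ⋀[ℂ]^n (ι → ℂ)) (X : Matrix ι ι ℂ) :
    ∃ w : ⋀[ℂ]^n (ι → ℂ), ∀ ψ, der v ψ X = ψ w := by
  refine ⟨∑ K, (extBasis ι n).repr v K • ∑ p, exteriorPower.ιMulti ℂ n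
      (Function.update (fun p => (Pi.single (enum K p) 1 : ι → ℂ)) p
        (fun i => X i (enum K p))), fun ψ => ?_⟩
  simp only [der, LinearMap.sum_apply, LinearMap.smul_apply, derBasis_apply, map_sum, map_smul]

lemma annihilates_iff_coord (X : Matrix ι ι ℂ) (v : ⋀[ℂ]^n (ι → ℂ)) :
    Annihilates X v ↔ ∀ J, der v ((extBasis ι n).coord J) X = 0 := by
  refine ⟨fun h J => h _, fun h ψ => ?_⟩
  obtain ⟨w, hw⟩ := exists_der_eq v X
  have : w = 0 := (extBasis ι n).repr.map_eq_zero_iff.1 (Finsupp.ext fun J => by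
    rw [← Basis.coord_apply, ← hw, h]; rfl)
  rw [hw, this, map_zero]

/-- The coordinates of `A v`, as a function of the matrix `A`. -/
def extCoords (v : ⋀[ℂ]^n (ι → ℂ)) (A : Matrix ι ι ℂ) (J : Set.powersetCard ι n) : ℂ :=
  (extBasis ι n).coord J (extAct n A v)

lemma extCoords_eq_iff (v : ⋀[ℂ]^n (ι → ℂ)) (A B : Matrix ι ι ℂ) :
    extCoords v A = extCoords v B ↔ extAct n A v = extAct n B v :=
  ⟨fun h => (extBasis ι n).repr.injective (Finsupp.ext fun J => congrFun h J),
    fun h => by funext J; rw [extCoords, h]; rfl⟩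

lemma continuous_extCoords (v : ⋀[ℂ]^n (ι → ℂ)) : Continuous (extCoords v) := by
  refine continuous_pi fun J => ?_
  simp only [extCoords, Basis.coord_apply, repr_extAct_apply]
  exact continuous_finsetSum _ fun K _ => continuous_const.mul
    (continuous_id.matrix_submatrix _ _).matrix_det

/-- Trivial infinitesimal stabiliser means that the derivative of `A ↦ Av` at `1` is injective. In
finite dimension it is then bounded below, so the value at `1` is not taken again nearby. -/
lemma eventually_extAct_ne (v : ⋀[ℂ]^n (ι → ℂ))
    (hann : ∀ X : Matrix ι ι ℂ, Annihilates X v → X = 0) :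
    ∀ᶠ A in nhdsWithin (1 : Matrix ι ι ℂ) {1}ᶜ, extAct n A v ≠ v := by
  have h : HasFDerivAt (extCoords v) (ContinuousLinearMap.pi fun J =>
      (der v ((extBasis ι n).coord J)).toContinuousLinearMap) (1 : Matrix ι ι ℂ) :=
    hasFDerivAt_pi.2 fun J => hasFDerivAt_extAct v _
  obtain ⟨C, -, hC⟩ := LinearMap.exists_antilipschitzWith
    (LinearMap.pi fun J => der v ((extBasis ι n).coord J)) (LinearMap.ker_eq_bot'.2 fun X hX =>
      hann X ((annihilates_iff_coord X v).2 fun J => congrFun hX J))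
  filter_upwards [h.eventually_ne (c := extCoords v 1) ⟨C, hC⟩] with A hA hA'
  exact hA ((extCoords_eq_iff v A 1).2 (by rw [hA', extAct_one]; rfl))

/-- The stabiliser in the special linear group of a critical vector of an exterior power whose
infinitesimal stabiliser is trivial is finite. -/
theorem finite_stabilizer_of_critical (v : ⋀[ℂ]^n (ι → ℂ))
    (hcrit : ∀ X : Matrix ι ι ℂ, X.trace = 0 → der v (extDual v) X = 0)
    (hann : ∀ X : Matrix ι ι ℂ, Annihilates X v → X = 0) :
    {A : Matrix ι ι ℂ | A.det = 1 ∧ extAct n A v = v}.Finite := by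
  by_contra hinf
  set S := {A : Matrix ι ι ℂ | A.det = 1 ∧ extAct n A v = v} with hS
  have hunit : ∀ A ∈ S, A.conjTranspose * A = 1 := fun A hA =>
    conjTranspose_mul_self_of_extAct_eq v hcrit hann A hA.1 hA.2
  have hclosed : IsClosed S := by
    have : S = {A | A.det = 1} ∩ {A | extCoords v A = extCoords v 1} := by
      ext A
      simp only [hS, Set.mem_ofPred_eq, Set.mem_inter_iff, extCoords_eq_iff, extAct_one,
        LinearMap.id_apply]
    rw [this]
    exact (isClosed_eq (continuous_id.matrix_det) continuous_const).inter
      (isClosed_eq (continuous_extCoords v) continuous_const)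
  -- The norm is the entrywise supremum, and the entries of a unitary matrix have modulus at most
  -- `1`.
  have hproper : ProperSpace (Matrix ι ι ℂ) := FiniteDimensional.proper ℂ _
  have hball : S ⊆ Metric.closedBall 0 1 := fun A hA => by
    rw [mem_closedBall_zero_iff, Matrix.norm_le_iff zero_le_one]
    exact entry_norm_bound_of_unitary (Matrix.mem_unitaryGroup_iff'.2 (hunit A hA))
  obtain ⟨A₀, -, hacc⟩ := Set.Infinite.exists_accPt_of_subset_isCompact hinf
    (isCompact_closedBall (0 : Matrix ι ι ℂ) 1) hball
  have hA₀ : A₀ ∈ S := hclosed.closure_subset hacc.clusterPt.mem_closure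
  have hA₀' : A₀ * A₀.conjTranspose = 1 := mul_eq_one_comm.1 (hunit A₀ hA₀)
  have hfix : extAct n A₀.conjTranspose v = v := by
    conv_lhs => rw [← hA₀.2]
    rw [← extAct_mul_apply, hunit A₀ hA₀, extAct_one, LinearMap.id_apply]
  -- Translation by `A₀⁻¹ = A₀*`, which also fixes `v`, moves the accumulation point to `1`, where
  -- `eventually_extAct_ne` applies.
  have htend : Filter.Tendsto (fun A => A₀.conjTranspose * A) (nhdsWithin A₀ {A₀}ᶜ)
      (nhdsWithin 1 {1}ᶜ) := by
    refine tendsto_nhdsWithin_iff.2 ⟨?_, ?_⟩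
    · have : Continuous fun A : Matrix ι ι ℂ => A₀.conjTranspose * A :=
        continuous_const.matrix_mul continuous_id
      have h := this.tendsto A₀
      rw [hunit A₀ hA₀] at h
      exact h.mono_left nhdsWithin_le_nhds
    · filter_upwards [self_mem_nhdsWithin] with A hA h
      apply hA
      have : A₀ * (A₀.conjTranspose * A) = A₀ := by
        rw [Set.mem_singleton_iff.1 h, mul_one]
      rwa [← mul_assoc, hA₀', one_mul] at this
  have hne := htend.eventually (eventually_extAct_ne v hann)
  obtain ⟨A, hA, hAS⟩ := ((accPt_iff_frequently_nhdsNE.1 hacc).and_eventually hne).exists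
  exact hAS (by rw [extAct_mul_apply, hA.2, hfix])

end ExteriorAction

/-! ### Monomial matrices and the invariance of `ϱ`. -/

namespace Rudvalis

lemma wedge_eq (K : Set.powersetCard (Fin 28) 14) : wedge K = extBasis (Fin 28) 14 K := by
  rw [extBasis_apply]; rfl

lemma map_eq_extAct (g : R28 →ₗ[ℂ] R28) :
    exteriorPower.map 14 g = extAct 14 (LinearMap.toMatrix' g) := by
  rw [extAct, Matrix.toLin'_toMatrix']

lemma monomial_single (k : Fin 28 → ℕ) (σ : Equiv.Perm (Fin 28)) (i : Fin 28) :
    monomial k σ (Pi.single i 1) = Complex.I ^ k (σ i) • (Pi.single (σ i) 1 : R28) := by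
  funext j
  change Complex.I ^ k j * (Pi.single i 1 : R28) (σ.symm j) = _
  by_cases h : j = σ i
  · subst h; simp
  · have : σ.symm j ≠ i := fun h' => h (by rw [← h', Equiv.apply_symm_apply])
    simp [h, this]

lemma monomial_mul (k k' : Fin 28 → ℕ) (σ σ' : Equiv.Perm (Fin 28)) :
    monomial k σ * monomial k' σ' = monomial (fun j => k j + k' (σ.symm j)) (σ * σ') := by
  ext v j
  change Complex.I ^ k j * (Complex.I ^ k' (σ.symm j) * v (σ'.symm (σ.symm j)))
    = Complex.I ^ (k j + k' (σ.symm j)) * v (σ'.symm (σ.symm j))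
  rw [pow_add, mul_assoc]

lemma monomial_inv (k : Fin 28 → ℕ) (σ : Equiv.Perm (Fin 28)) :
    (monomial k σ)⁻¹ = monomial (fun j => 3 * k (σ j)) σ⁻¹ := by
  rw [inv_eq_iff_mul_eq_one, monomial_mul]
  ext v j
  change Complex.I ^ (k j + 3 * k (σ (σ.symm j))) * v ((1 : Equiv.Perm (Fin 28)).symm _) = v j
  have : Complex.I ^ (k j + 3 * k j) = 1 := by
    rw [show k j + 3 * k j = 4 * k j by ring, pow_mul, Complex.I_pow_four, one_pow]
  have h2 : (1 : Equiv.Perm (Fin 28)).symm (σ⁻¹.symm (σ.symm j)) = j := σ.apply_symm_apply j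
  rw [Equiv.apply_symm_apply, this, one_mul]
  exact congrArg v h2

/-- The matrix of a monomial transformation. -/
def monMatrix (k : Fin 28 → ℕ) (σ : Equiv.Perm (Fin 28)) : Matrix (Fin 28) (Fin 28) ℂ :=
  Matrix.of fun i j => if i = σ j then Complex.I ^ k i else 0

lemma monMatrix_apply (k : Fin 28 → ℕ) (σ : Equiv.Perm (Fin 28)) (i j : Fin 28) :
    monMatrix k σ i j = if i = σ j then Complex.I ^ k i else 0 := rfl

lemma toMatrix'_monomial (k : Fin 28 → ℕ) (σ : Equiv.Perm (Fin 28)) :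
    LinearMap.toMatrix' (monomial k σ : R28 →ₗ[ℂ] R28) = monMatrix k σ := by
  ext i j
  rw [LinearMap.toMatrix'_apply, monMatrix_apply]
  change monomial k σ (Pi.single j 1) i = _
  rw [monomial_single]
  by_cases h : i = σ j
  · subst h; simp
  · simp [h]

lemma conj_I_pow_mul (m : ℕ) : Complex.I ^ m * starRingEnd ℂ (Complex.I ^ m) = 1 := by
  rw [map_pow, Complex.conj_I, ← mul_pow]
  simp

lemma monMatrix_mul_conjTranspose (k : Fin 28 → ℕ) (σ : Equiv.Perm (Fin 28)) :
    monMatrix k σ * (monMatrix k σ).conjTranspose = 1 := by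
  ext i j
  rw [Matrix.mul_apply, Matrix.one_apply]
  simp only [Matrix.conjTranspose_apply, monMatrix_apply]
  rw [Finset.sum_eq_single (σ.symm i)]
  · by_cases h : i = j
    · subst h; simp [← mul_pow]
    · have h' : j ≠ i := fun e => h e.symm
      simp [h, h']
  · intro b _ hb
    have : i ≠ σ b := fun e => hb (by rw [e, Equiv.symm_apply_apply])
    simp [this]
  · simp

/-- Conjugation by a monomial matrix, entrywise. -/
lemma monMatrix_conj_apply (k : Fin 28 → ℕ) (σ : Equiv.Perm (Fin 28))
    (X : Matrix (Fin 28) (Fin 28) ℂ) (i j : Fin 28) :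
    (monMatrix k σ * X * (monMatrix k σ).conjTranspose) (σ i) (σ j)
      = Complex.I ^ k (σ i) * X i j * starRingEnd ℂ (Complex.I ^ k (σ j)) := by
  rw [Matrix.mul_apply, Finset.sum_eq_single j, Matrix.mul_apply, Finset.sum_eq_single i]
  · simp [monMatrix_apply, Matrix.conjTranspose_apply]
  · intro b _ hb
    have : σ i ≠ σ b := fun e => hb (σ.injective e.symm)
    simp [monMatrix_apply, hb.symm]
  · simp
  · intro b _ hb
    simp [monMatrix_apply, Matrix.conjTranspose_apply, hb.symm]
  · simp

lemma exists_eq_monomial {g : R28 ≃ₗ[ℂ] R28} (hg : g ∈ monomialGroup) :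
    ∃ k σ, g = monomial k σ := by
  induction hg using Subgroup.closure_induction with
  | mem g hg =>
    rcases hg with ⟨D, -, rfl⟩ | hg
    · exact ⟨_, _, rfl⟩
    · simp only [Set.mem_insert_iff, Set.mem_singleton_iff] at hg
      rcases hg with rfl | rfl | rfl | rfl | rfl | rfl | rfl <;> exact ⟨_, _, rfl⟩
  | one => exact ⟨fun _ => 0, 1, by ext v j; simp [monomial]; rfl⟩
  | mul g h _ _ hg hh =>
    obtain ⟨k, σ, rfl⟩ := hg
    obtain ⟨k', σ', rfl⟩ := hh
    exact ⟨_, _, monomial_mul k k' σ σ'⟩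
  | inv g _ hg =>
    obtain ⟨k, σ, rfl⟩ := hg
    exact ⟨_, _, monomial_inv k σ⟩

/-- An alternating product of distinct basis vectors is, up to sign, a basis vector of the
exterior power. -/
lemma ιMulti_single_comp (f : Fin 14 → Fin 28) (hf : Function.Injective f)
    (J : Set.powersetCard (Fin 28) 14) (hJ : ∀ p, f p ∈ J) :
    ∃ m : ℕ, exteriorPower.ιMulti ℂ 14 (fun p => (Pi.single (f p) 1 : R28))
      = Complex.I ^ m • wedge J := by
  have h1 : ∀ p, ∃ q, enum J q = f p := fun p =>
    (Set.powersetCard.mem_range_ofFinEmbEquiv_symm_iff_mem J (f p)).2 (hJ p)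
  choose π hπ using h1
  have hinj : Function.Injective π := fun p q h => hf (by rw [← hπ, ← hπ, h])
  let e : Equiv.Perm (Fin 14) := Equiv.ofBijective π (Finite.injective_iff_bijective.1 hinj)
  have h2 : (fun p => (Pi.single (f p) 1 : R28))
      = (fun q => (Pi.single (enum J q) 1 : R28)) ∘ e := by
    funext p; rw [← hπ p]; rfl
  have h3 : wedge J = exteriorPower.ιMulti ℂ 14 (fun q => (Pi.single (enum J q) 1 : R28)) := rfl
  rw [h2, AlternatingMap.map_perm, ← h3]
  rcases Int.units_eq_one_or (Equiv.Perm.sign e) with h | h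
  · exact ⟨0, by simp [h]⟩
  · exact ⟨2, by 
      rw [h, Units.neg_smul, one_smul, Complex.I_sq]
      exact (neg_one_smul ℂ (wedge J)).symm⟩

lemma map_monomial_wedge (k : Fin 28 → ℕ) (σ : Equiv.Perm (Fin 28))
    (K : Set.powersetCard (Fin 28) 14) :
    ∃ (m : ℕ) (J : Set.powersetCard (Fin 28) 14),
      exteriorPower.map 14 (monomial k σ : R28 →ₗ[ℂ] R28) (wedge K) = Complex.I ^ m • wedge J := by
  have h : exteriorPower.map 14 (monomial k σ : R28 →ₗ[ℂ] R28) (wedge K)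
      = (∏ p, Complex.I ^ k (σ (enum K p))) •
        exteriorPower.ιMulti ℂ 14 (fun p => (Pi.single (σ (enum K p)) 1 : R28)) := by
    rw [← AlternatingMap.map_smul_univ, wedge, exteriorPower.ιMulti_family,
      exteriorPower.map_apply_ιMulti]
    congr 1
    funext p
    exact monomial_single k σ _
  let J : Set.powersetCard (Fin 28) 14 := Set.powersetCard.map 14 σ.toEmbedding K
  obtain ⟨m, hm⟩ := ιMulti_single_comp (fun p => σ (enum K p))
    (σ.injective.comp (enum K).injective) J (fun p => by
      have : enum K p ∈ K := (Set.powersetCard.mem_range_ofFinEmbEquiv_symm_iff_mem K _).1 ⟨p, rfl⟩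
      exact Finset.mem_map_of_mem _ this)
  refine ⟨(∑ p, k (σ (enum K p))) + m, J, ?_⟩
  rw [h, hm, smul_smul, pow_add, Finset.prod_pow_eq_pow_sum]

lemma I_pow_mod (m : ℕ) : Complex.I ^ (m % 4) = Complex.I ^ m :=
  (Complex.I_pow_eq_pow_mod m).symm

lemma extAct_mem_wedgeOrbit {g : R28 ≃ₗ[ℂ] R28} (hg : g ∈ monomialGroup)
    {I : Set.powersetCard (Fin 28) 14} {v : Ext14} (hv : v ∈ wedgeOrbit I) :
    exteriorPower.map 14 (g : R28 →ₗ[ℂ] R28) v ∈ wedgeOrbit I := by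
  obtain ⟨h, hh, rfl⟩ := hv
  refine ⟨g * h, mul_mem hg hh, ?_⟩
  rw [← LinearMap.comp_apply, ← exteriorPower.map_comp]; rfl

lemma map_injective (g : R28 ≃ₗ[ℂ] R28) :
    Function.Injective (exteriorPower.map 14 (g : R28 →ₗ[ℂ] R28)) :=
  exteriorPower.map_injective (g.symm : R28 →ₗ[ℂ] R28) (by ext; simp)

lemma smul_wedge_injective {c d : ℂ} (hc : c ≠ 0) {J K : Set.powersetCard (Fin 28) 14}
    (h : c • wedge J = d • wedge K) : J = K ∧ c = d := by
  have h1 := congrArg (fun v => (extBasis (Fin 28) 14).repr v J) h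
  simp only [wedge_eq, map_smul, Basis.repr_self, Finsupp.smul_apply, Finsupp.single_eq_same,
    smul_eq_mul, mul_one] at h1
  by_cases hJK : J = K
  · subst hJK; simp at h1; exact ⟨rfl, h1⟩
  · rw [Finsupp.single_eq_of_ne hJK, mul_zero] at h1
    exact absurd h1 hc

lemma I_pow_fin_injective {k l : Fin 4} (h : Complex.I ^ (k : ℕ) = Complex.I ^ (l : ℕ)) :
    k = l := by
  fin_cases k <;> fin_cases l <;>
    first
    | rfl
    | (exfalso; norm_num [Complex.ext_iff, pow_succ] at h)

/-- The orbit sum `t_I` is invariant under the monomial group. -/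
lemma map_orbitInvariant {g : R28 ≃ₗ[ℂ] R28} (hg : g ∈ monomialGroup)
    (I : Set.powersetCard (Fin 28) 14) :
    exteriorPower.map 14 (g : R28 →ₗ[ℂ] R28) (orbitInvariant I) = orbitInvariant I := by
  classical
  let f : Set.powersetCard (Fin 28) 14 × Fin 4 → Ext14 := fun x => Complex.I ^ (x.2 : ℕ) • wedge x.1
  have hf : Function.Injective f := fun x y h => by
    obtain ⟨h1, h2⟩ := smul_wedge_injective (pow_ne_zero _ Complex.I_ne_zero) h
    exact Prod.ext h1 (I_pow_fin_injective h2)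
  -- The vectors `i ^ k a_J` are pairwise distinct, so `t_I` is the sum over the finite set `T` of
  -- those in the orbit. A monomial transformation maps `T` injectively into itself, hence permutes
  -- it.
  let T : Finset Ext14 := (Finset.univ.image f).filter (· ∈ wedgeOrbit I)
  have hT : orbitInvariant I = ∑ v ∈ T, v := by
    rw [Finset.sum_filter, Finset.sum_image fun x _ y _ h => hf h, Fintype.sum_prod_type]
    refine Finset.sum_congr rfl fun J _ => ?_
    rw [gam, Finset.sum_smul]
    refine Finset.sum_congr rfl fun k _ => ?_
    simp only [f, ite_smul, zero_smul]
  have hsub : T.image (exteriorPower.map 14 (g : R28 →ₗ[ℂ] R28)) ⊆ T := by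
    intro v hv
    obtain ⟨w, hw, rfl⟩ := Finset.mem_image.1 hv
    obtain ⟨hw1, hw2⟩ := Finset.mem_filter.1 hw
    obtain ⟨⟨J, k⟩, -, rfl⟩ := Finset.mem_image.1 hw1
    refine Finset.mem_filter.2 ⟨?_, extAct_mem_wedgeOrbit hg hw2⟩
    obtain ⟨k', σ, rfl⟩ := exists_eq_monomial hg
    obtain ⟨m, J', hm⟩ := map_monomial_wedge k' σ J
    refine Finset.mem_image.2 ⟨(J', ⟨(k + m) % 4, Nat.mod_lt _ (by norm_num)⟩),
      Finset.mem_univ _, ?_⟩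
    simp only [f]
    rw [I_pow_mod, map_smul, hm, smul_smul, pow_add]
  have heq : T.image (exteriorPower.map 14 (g : R28 →ₗ[ℂ] R28)) = T :=
    Finset.eq_of_subset_of_card_le hsub
      (Finset.card_image_of_injective _ (map_injective g)).ge
  rw [hT, map_sum]
  conv_rhs => rw [← heq]
  rw [Finset.sum_image fun x _ y _ h => map_injective g h]

lemma map_rho {g : R28 ≃ₗ[ℂ] R28} (hg : g ∈ monomialGroup) :
    exteriorPower.map 14 (g : R28 →ₗ[ℂ] R28) rho = rho := by
  simp only [rho, map_smul, map_sum, map_add, map_orbitInvariant hg]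

/-! ### Double transitivity on `Δ`, and separation of points by dozens. -/

/-- The coordinate permutations underlying the monomial group. -/
def coordPerms : Subgroup (Equiv.Perm (Fin 28)) where
  carrier := {σ | ∃ k, monomial k σ ∈ monomialGroup}
  one_mem' := ⟨fun _ => 0, by
    convert monomialGroup.one_mem
    ext v j; simp [monomial]; rfl⟩
  mul_mem' := by
    rintro σ σ' ⟨k, hk⟩ ⟨k', hk'⟩
    exact ⟨_, by rw [← monomial_mul]; exact mul_mem hk hk'⟩
  inv_mem' := by
    rintro σ ⟨k, hk⟩
    exact ⟨_, by rw [← monomial_inv]; exact inv_mem hk⟩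

lemma signChange_mem {D : Finset (Fin 28)} (hD : D ∈ dozens) : signChange D ∈ monomialGroup :=
  Subgroup.subset_closure (Or.inl ⟨D, hD, rfl⟩)

lemma coordPerm_permQ_mem : coordPerm permQ ∈ monomialGroup :=
  Subgroup.subset_closure (Or.inr (by simp))

lemma coordPerm_permF03_mem : coordPerm permF03 ∈ monomialGroup :=
  Subgroup.subset_closure (Or.inr (by simp))

lemma coordPerm_permV_mem : coordPerm permV ∈ monomialGroup :=
  Subgroup.subset_closure (Or.inr (by simp))

lemma monomial_permN356_mem : monomial (fun _ => 1) permN356 ∈ monomialGroup :=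
  Subgroup.subset_closure (Or.inr (by simp))

lemma monomial_permM_mem : monomial expM permM ∈ monomialGroup :=
  Subgroup.subset_closure (Or.inr (by simp))

lemma permQ_mem : permQ ∈ coordPerms := ⟨_, coordPerm_permQ_mem⟩
lemma permV_mem : permV ∈ coordPerms := ⟨_, coordPerm_permV_mem⟩
lemma permN356_mem : permN356 ∈ coordPerms := ⟨_, monomial_permN356_mem⟩
lemma permM_mem : permM ∈ coordPerms := ⟨_, monomial_permM_mem⟩

/-- Twenty-seven permutations fixing `∞` which form a regular set on the other points. -/
def regularPerm (x : Fin 3 × Fin 3 × Fin 3) : Equiv.Perm (Fin 28) :=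
  permQ ^ (x.1 : ℕ) * permV ^ (x.2.1 : ℕ) * (permN356 * permV * permN356 ^ 3) ^ (x.2.2 : ℕ)

lemma regularPerm_mem (x : Fin 3 × Fin 3 × Fin 3) : regularPerm x ∈ coordPerms :=
  mul_mem (mul_mem (pow_mem permQ_mem _) (pow_mem permV_mem _))
    (pow_mem (mul_mem (mul_mem permN356_mem permV_mem) (pow_mem permN356_mem _)) _)

set_option maxRecDepth 100000 in
lemma regularPerm_last (x : Fin 3 × Fin 3 × Fin 3) : regularPerm x 27 = 27 := by
  revert x; decide +kernel

set_option maxRecDepth 100000 in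
lemma image_regularPerm (j : Fin 28) (hj : j ≠ 27) :
    Finset.univ.image (fun x => regularPerm x j) = Finset.univ.erase 27 := by
  revert j; decide +kernel

/-- The 27 images of `j` exhaust the 27 points other than `∞`, so each is attained exactly once. -/
lemma sum_regularPerm (f : Fin 28 → ℂ) (j : Fin 28) (hj : j ≠ 27) :
    ∑ x, f (regularPerm x j) = ∑ i, f i - f 27 := by
  have h := image_regularPerm j hj
  have hinj : Set.InjOn (fun x => regularPerm x j) (Finset.univ : Finset (Fin 3 × Fin 3 × Fin 3)) :=
    Finset.card_image_iff.1 (by rw [h]; rfl)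
  rw [← Finset.sum_image (f := f) hinj, h, Finset.sum_erase_eq_sub (Finset.mem_univ _)]

lemma exists_regularPerm (i j : Fin 28) (hi : i ≠ 27) (hj : j ≠ 27) :
    ∃ σ ∈ coordPerms, σ i = j ∧ σ 27 = 27 := by
  have h : j ∈ Finset.univ.image (fun x => regularPerm x i) := by
    rw [image_regularPerm i hi]; simp [hj]
  obtain ⟨x, -, hx⟩ := Finset.mem_image.1 h
  exact ⟨_, regularPerm_mem x, hx, regularPerm_last x⟩

lemma exists_perm_last (i : Fin 28) : ∃ σ ∈ coordPerms, σ i = 27 := by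
  by_cases hi : i = 27
  · exact ⟨1, one_mem _, hi⟩
  · obtain ⟨σ, hσ, h, -⟩ := exists_regularPerm i 12 hi (by decide)
    -- Position `12` is the label `13`, which `μ` exchanges with `∞`.
    have hM : permM 12 = 27 := by decide +kernel
    exact ⟨permM * σ, mul_mem permM_mem hσ, by rw [Equiv.Perm.mul_apply, h, hM]⟩

/-- Double transitivity: `j` is moved to `∞`, and then the other point by a permutation fixing `∞`.
The target `(18, 27)` is the entry studied later. -/
lemma exists_perm_pair (i j : Fin 28) (hij : i ≠ j) :
    ∃ σ ∈ coordPerms, σ i = 18 ∧ σ j = 27 := by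
  obtain ⟨σ, hσ, h⟩ := exists_perm_last j
  obtain ⟨τ, hτ, h1, h2⟩ := exists_regularPerm (σ i) 18
    (fun e => hij (σ.injective (e.trans h.symm))) (by decide)
  exact ⟨τ * σ, mul_mem hτ hσ, h1, by rw [Equiv.Perm.mul_apply, h, h2]⟩

-- For `i ≠ j` some sign change acts on the matrix unit at `(i, j)` by `-1`, so an invariant
-- functional vanishes there.
set_option maxRecDepth 100000 in
lemma dozens_separate (i j : Fin 28) (hij : i ≠ j) :
    ∃ D ∈ dozens, ¬(i ∈ D ↔ j ∈ D) := by
  revert i j; decide +kernel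

/-- A monomial matrix is unitary, so its conjugate transpose is its inverse and fixes `ϱ` as well.
-/
lemma extAct_rho {k : Fin 28 → ℕ} {σ : Equiv.Perm (Fin 28)} (h : monomial k σ ∈ monomialGroup) :
    extAct 14 (monMatrix k σ).conjTranspose rho = rho := by
  have h1 : extAct 14 (monMatrix k σ) rho = rho := by
    rw [← toMatrix'_monomial, ← map_eq_extAct]; exact map_rho h
  conv_lhs => rw [← h1]
  rw [← extAct_mul_apply, mul_eq_one_comm.1 (monMatrix_mul_conjTranspose k σ), extAct_one]; rfl

lemma I_pow_mul_conj_ne_zero (a b : ℕ) :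
    Complex.I ^ a * starRingEnd ℂ (Complex.I ^ b) ≠ 0 :=
  mul_ne_zero (pow_ne_zero _ Complex.I_ne_zero)
    ((map_ne_zero _).2 (pow_ne_zero _ Complex.I_ne_zero))

lemma monMatrix_conj_single (k : Fin 28 → ℕ) (σ : Equiv.Perm (Fin 28)) (i j : Fin 28) :
    monMatrix k σ * Matrix.single i j 1 * (monMatrix k σ).conjTranspose
      = (Complex.I ^ k (σ i) * starRingEnd ℂ (Complex.I ^ k (σ j))) •
        Matrix.single (σ i) (σ j) (1 : ℂ) := by
  ext a b
  obtain ⟨a, rfl⟩ := σ.surjective a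
  obtain ⟨b, rfl⟩ := σ.surjective b
  rw [monMatrix_conj_apply]
  simp only [Matrix.smul_apply, Matrix.single_apply, σ.injective.eq_iff, smul_eq_mul]
  by_cases h : i = a ∧ j = b
  · obtain ⟨rfl, rfl⟩ := h; simp
  · simp [h]

/-! ### Criticality of `ϱ`. -/

/-- `ϱ` is a critical vector. -/
theorem der_rho_eq_zero (X : Matrix (Fin 28) (Fin 28) ℂ) (hX : X.trace = 0) :
    der rho (extDual rho) X = 0 := by
  -- Invariance of the moment functional under conjugation, evaluated on matrix units.
  have hinv : ∀ (k : Fin 28 → ℕ) (σ : Equiv.Perm (Fin 28)), monomial k σ ∈ monomialGroup →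
      ∀ i j, (Complex.I ^ k (σ i) * starRingEnd ℂ (Complex.I ^ k (σ j))) *
        der rho (extDual rho) (Matrix.single (σ i) (σ j) 1)
          = der rho (extDual rho) (Matrix.single i j 1) := by
    intro k σ h i j
    rw [← smul_eq_mul, ← map_smul, ← monMatrix_conj_single,
      der_extDual_conj _ _ _ (monMatrix_mul_conjTranspose k σ), extAct_rho h]
  have hoff : ∀ i j, i ≠ j → der rho (extDual rho) (Matrix.single i j 1) = 0 := by
    intro i j hij
    obtain ⟨D, hD, hD'⟩ := dozens_separate i j hij
    have h := hinv _ _ (signChange_mem hD) i j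
    simp only [Equiv.Perm.one_apply] at h
    by_cases hi : i ∈ D <;> by_cases hj : j ∈ D <;> simp [hi, hj] at hD' h <;>
    · exact self_eq_neg.1 h.symm
  have hdiag : ∀ i, der rho (extDual rho) (Matrix.single i i 1)
      = der rho (extDual rho) (Matrix.single 27 27 1) := by
    intro i
    obtain ⟨σ, ⟨k, hk⟩, h⟩ := exists_perm_last i
    rw [← hinv k σ hk i i, h, conj_I_pow_mul, one_mul]
  have hsum : X = ∑ i, ∑ j, X i j • Matrix.single i j (1 : ℂ) := by
    conv_lhs => rw [Matrix.matrix_eq_sum_single X]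
    simp
  rw [hsum]
  simp only [map_sum, map_smul]
  have : ∀ i, ∑ j, X i j • der rho (extDual rho) (Matrix.single i j 1)
      = X i i * der rho (extDual rho) (Matrix.single 27 27 1) := by
    intro i
    rw [Finset.sum_eq_single i (fun j _ hj => by rw [hoff i j hj.symm, smul_zero]) (by simp),
      hdiag, smul_eq_mul]
  rw [Finset.sum_congr rfl fun i _ => this i, ← Finset.sum_mul]
  change X.trace * _ = 0
  rw [hX, zero_mul]

/-! ### The infinitesimal stabiliser: reduction to one off-diagonal entry. -/

lemma annihilates_conj {k : Fin 28 → ℕ} {σ : Equiv.Perm (Fin 28)}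
    (h : monomial k σ ∈ monomialGroup) {X : Matrix (Fin 28) (Fin 28) ℂ} (hX : Annihilates X rho) :
    Annihilates (monMatrix k σ * X * (monMatrix k σ).conjTranspose) rho :=
  Annihilates.conj (monMatrix_mul_conjTranspose k σ) (by rwa [extAct_rho h])

lemma annihilates_diagonal_comp {σ : Equiv.Perm (Fin 28)} (h : σ ∈ coordPerms) {x : Fin 28 → ℂ}
    (hx : Annihilates (Matrix.diagonal x) rho) : Annihilates (Matrix.diagonal (x ∘ σ)) rho := by
  -- Conjugation by a monomial matrix over `τ` turns `x` into `x ∘ τ⁻¹`, so `τ = σ⁻¹` is needed.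
  obtain ⟨k, hk⟩ := inv_mem h
  convert annihilates_conj hk hx
  ext a b
  obtain ⟨a, rfl⟩ := (σ⁻¹).surjective a
  obtain ⟨b, rfl⟩ := (σ⁻¹).surjective b
  rw [monMatrix_conj_apply]
  by_cases hab : a = b
  · subst hab
    rw [Matrix.diagonal_apply_eq, Matrix.diagonal_apply_eq, mul_right_comm, conj_I_pow_mul]
    simp
  · rw [Matrix.diagonal_apply_ne _ hab, Matrix.diagonal_apply_ne _ (by simpa using hab)]
    simp

/-- The coefficient of `ϱ` at `K`. -/
def coeffRho (K : Set.powersetCard (Fin 28) 14) : ℂ := (extBasis (Fin 28) 14).repr rho K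

/-- A diagonal matrix multiplies the coordinate at `K` by its weight there, so this weight must
vanish wherever the coordinate does not. -/
lemma sum_eq_zero_of_annihilates_diagonal {K : Set.powersetCard (Fin 28) 14} (hK : coeffRho K ≠ 0)
    {x : Fin 28 → ℂ} (hx : Annihilates (Matrix.diagonal x) rho) : ∑ i ∈ (K : Finset _), x i = 0 := by
  have h := hx ((extBasis (Fin 28) 14).coord K)
  rw [der_diagonal, Finset.sum_eq_single K] at h
  · have h' : ∑ p, x (enum K p) = 0 := by
      have h2 : (extBasis (Fin 28) 14).repr rho K = 0 ∨ ∑ p, x (enum K p) = 0 := by simpa using h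
      exact h2.resolve_left hK
    rw [← h', ← Finset.sum_image (g := enum K) (f := x) fun p _ q _ e => (enum K).injective e]
    refine Finset.sum_congr ?_ fun _ _ => rfl
    ext i
    have := Set.powersetCard.mem_range_ofFinEmbEquiv_symm_iff_mem K i
    simp only [Finset.mem_image, Finset.mem_univ, true_and]
    exact this.symm
  · intro J _ hJ
    simp [Finsupp.single_eq_of_ne hJ.symm]
  · simp

lemma diagonal_eq_zero_of_annihilates (K : Set.powersetCard (Fin 28) 14) (hK : coeffRho K ≠ 0)
    (h27 : (27 : Fin 28) ∈ (K : Finset _)) {x : Fin 28 → ℂ}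
    (hx : Annihilates (Matrix.diagonal x) rho) : x = 0 := by
  -- Add the relations `∑_{i ∈ K} y (s i) = 0` over the 27 permutations `s`: `∞` contributes `27
  -- y_∞`, and each of the other 13 points of `K` contributes `∑ y - y_∞`.
  have key : ∀ y : Fin 28 → ℂ, Annihilates (Matrix.diagonal y) rho →
      14 * y 27 + 13 * ∑ i, y i = 0 := by
    intro y hy
    have h1 : ∑ j ∈ (K : Finset _), ∑ s, y (regularPerm s j) = 0 := by
      rw [Finset.sum_comm]
      exact Finset.sum_eq_zero fun s _ => sum_eq_zero_of_annihilates_diagonal hK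
        (annihilates_diagonal_comp (regularPerm_mem s) hy)
    rw [← Finset.add_sum_erase _ _ h27, Finset.sum_congr rfl fun j hj =>
      sum_regularPerm y j (Finset.ne_of_mem_erase hj), Finset.sum_const,
      Finset.card_erase_of_mem h27, Set.powersetCard.card_eq] at h1
    simp only [regularPerm_last, Finset.sum_const, Finset.card_univ, Fintype.card_prod,
      Fintype.card_fin, nsmul_eq_mul] at h1
    push_cast at h1
    linear_combination h1
  have key' : ∀ i, 14 * x i + 13 * ∑ j, x j = 0 := by
    intro i
    obtain ⟨σ, hσ, h⟩ := exists_perm_last i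
    have := key (x ∘ (σ⁻¹ : Equiv.Perm (Fin 28))) (annihilates_diagonal_comp (inv_mem hσ) hx)
    have h3 : σ⁻¹ 27 = i := by rw [← h]; exact σ.symm_apply_apply i
    rw [Function.comp_apply, h3] at this
    rwa [show ∑ j, (x ∘ (σ⁻¹ : Equiv.Perm (Fin 28))) j = ∑ j, x j from
      Equiv.sum_comp (σ⁻¹) x] at this
  have hs : ∑ j, x j = 0 := by
    have : ∑ i : Fin 28, (14 * x i + 13 * ∑ j, x j) = 0 := Finset.sum_eq_zero fun i _ => key' i
    rw [Finset.sum_add_distrib, ← Finset.mul_sum, Finset.sum_const, Finset.card_univ,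
      Fintype.card_fin, nsmul_eq_mul] at this
    push_cast at this
    -- The number is `14 + 28 * 13`.
    have h2 : (378 : ℂ) * ∑ j, x j = 0 := by linear_combination this
    simpa using h2
  funext i
  have := key' i
  rw [hs] at this
  simpa using this

/-- A matrix annihilating `ϱ` vanishes if all such matrices have the same vanishing off-diagonal
entry. -/
lemma eq_zero_of_annihilates (K : Set.powersetCard (Fin 28) 14) (hK : coeffRho K ≠ 0)
    (h27 : (27 : Fin 28) ∈ (K : Finset _))
    (hentry : ∀ X : Matrix (Fin 28) (Fin 28) ℂ, Annihilates X rho → X 18 27 = 0)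
    (X : Matrix (Fin 28) (Fin 28) ℂ) (hX : Annihilates X rho) : X = 0 := by
  have hoff : ∀ i j, i ≠ j → X i j = 0 := by
    intro i j hij
    obtain ⟨σ, ⟨k, hk⟩, h1, h2⟩ := exists_perm_pair i j hij
    have h := hentry _ (annihilates_conj hk hX)
    rw [← h1, ← h2, monMatrix_conj_apply, mul_right_comm] at h
    exact (mul_eq_zero.1 h).resolve_left (I_pow_mul_conj_ne_zero _ _)
  have hdiag : X = Matrix.diagonal fun i => X i i := by
    ext i j
    by_cases hij : i = j
    · subst hij; simp
    · rw [hoff i j hij, Matrix.diagonal_apply_ne _ hij]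
  rw [hdiag] at hX ⊢
  rw [diagonal_eq_zero_of_annihilates K hK h27 hX]
  exact Matrix.diagonal_zero

/-! ### Vanishing coefficients, and the entry at `(19, ∞)`. -/

lemma extInner_wedge_rho (K : Set.powersetCard (Fin 28) 14) (c : ℂ) :
    extInner (c • wedge K) rho = starRingEnd ℂ c * coeffRho K := by
  rw [wedge_eq, extInner, Finset.sum_eq_single K]
  · simp [coeffRho]
  · intro J _ hJ
    simp [Finsupp.single_eq_of_ne hJ]
  · simp

/-- The coefficient of `ϱ` at `K` vanishes if the monomial group acts nontrivially on the line
spanned by `a_K`. -/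
lemma coeffRho_eq_zero_of_map {g : R28 ≃ₗ[ℂ] R28} (hg : g ∈ monomialGroup)
    {K : Set.powersetCard (Fin 28) 14} {c : ℂ} (hc : c ≠ 1)
    (h : exteriorPower.map 14 (g : R28 →ₗ[ℂ] R28) (wedge K) = c • wedge K) : coeffRho K = 0 := by
  obtain ⟨k, σ, rfl⟩ := exists_eq_monomial hg
  rw [map_eq_extAct, toMatrix'_monomial] at h
  -- Pairing `g a_K = c a_K` with `ϱ` and moving `g` across the form gives `conj c * coeffRho K =
  -- coeffRho K`.
  have h1 := extInner_extAct (monMatrix k σ) (wedge K) rho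
  rw [extAct_rho hg, h, extInner_wedge_rho] at h1
  have h2 := extInner_wedge_rho K 1
  rw [one_smul, map_one, one_mul] at h2
  rw [h2] at h1
  have h3 : (starRingEnd ℂ c - 1) * coeffRho K = 0 := by linear_combination h1
  refine (mul_eq_zero.1 h3).resolve_left fun h4 => hc ?_
  have := congrArg (starRingEnd ℂ) (sub_eq_zero.1 h4)
  simpa using this

lemma prod_enum (K : Set.powersetCard (Fin 28) 14) (f : Fin 28 → ℂ) :
    ∏ p, f (enum K p) = ∏ i ∈ (K : Finset _), f i := by
  rw [← Finset.prod_image (g := enum K) (f := f) fun p _ q _ e => (enum K).injective e]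
  refine Finset.prod_congr ?_ fun _ _ => rfl
  ext i
  have := Set.powersetCard.mem_range_ofFinEmbEquiv_symm_iff_mem K i
  simp only [Finset.mem_image, Finset.mem_univ, true_and]
  exact this

/-- The sign change on `D` multiplies `a_K` by `(-1)^|K ∩ D|`. -/
lemma coeffRho_eq_zero_of_odd {D : Finset (Fin 28)} (hD : D ∈ dozens)
    {K : Set.powersetCard (Fin 28) 14} (h : Odd ((K : Finset _) ∩ D).card) : coeffRho K = 0 := by
  refine coeffRho_eq_zero_of_map (signChange_mem hD) (c := -1) (by norm_num) ?_
  have h1 : monMatrix (fun j => if j ∈ D then 2 else 0) 1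
      = Matrix.diagonal fun j => if j ∈ D then (-1 : ℂ) else 1 := by
    ext i j
    rw [monMatrix_apply, Matrix.diagonal_apply, Equiv.Perm.one_apply]
    by_cases hi : i ∈ D <;> simp [hi]
  rw [map_eq_extAct, signChange, toMatrix'_monomial, h1, wedge_eq, extAct_diagonal,
    prod_enum K fun j => if j ∈ D then (-1 : ℂ) else 1, Finset.prod_ite, Finset.prod_const,
    Finset.filter_mem_eq_inter, h.neg_one_pow]
  simp

/-- The `14`-set obtained from the second representative by exchanging two elements. -/
def exchanged : Set.powersetCard (Fin 28) 14 :=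
  ⟨insert 18 ((ptSet (rhoTable 1).1).erase 27), by
    rw [Set.powersetCard.mem_iff]; decide⟩

/-- The other neighbour of `exchanged` whose intersections with all dozens are even. -/
def evenNeighbour : Set.powersetCard (Fin 28) 14 :=
  ⟨{1, 2, 3, 5, 6, 7, 9, 11, 12, 13, 16, 17, 18, 19}, by
    rw [Set.powersetCard.mem_iff]; decide⟩

-- Taking `j = i` is allowed, so `exchanged` itself is covered: it too meets some dozen in an odd
-- number of points.
set_option maxRecDepth 100000 in
lemma neighbour_cases : ∀ i ∈ (exchanged : Finset (Fin 28)), ∀ j,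
    j ∉ (exchanged : Finset (Fin 28)).erase i →
    insert j ((exchanged : Finset (Fin 28)).erase i) = (rep 1 : Finset (Fin 28)) ∨
    insert j ((exchanged : Finset (Fin 28)).erase i) = (evenNeighbour : Finset (Fin 28)) ∨
    ∃ D ∈ dozens, Odd ((insert j ((exchanged : Finset (Fin 28)).erase i)) ∩ D).card := by
  decide +kernel

lemma exists_eq_insert_erase {J K : Set.powersetCard (Fin 28) 14} {i : Fin 28}
    (hi : i ∈ (J : Finset _)) (h : (J : Finset _).erase i ⊆ K) :
    ∃ j, j ∉ (J : Finset _).erase i ∧ (K : Finset _) = insert j ((J : Finset _).erase i) := by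
  have hJ := Set.powersetCard.card_eq J
  have hK := Set.powersetCard.card_eq K
  have hc : ((J : Finset _).erase i).card = 13 := by rw [Finset.card_erase_of_mem hi, hJ]
  obtain ⟨j, hj⟩ := Finset.card_eq_one.1 (show ((K : Finset _) \ (J : Finset _).erase i).card = 1 by
    rw [Finset.card_sdiff_of_subset h, hc, hK])
  have hj' : j ∈ (K : Finset _) \ (J : Finset _).erase i := by rw [hj]; simp
  refine ⟨j, (Finset.mem_sdiff.1 hj').2, ?_⟩
  rw [Finset.insert_eq, ← hj, Finset.sdiff_union_of_subset h]

lemma coeffRho_eq_zero_of_neighbour (h0 : coeffRho evenNeighbour = 0)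
    {K : Set.powersetCard (Fin 28) 14} (hK : K ≠ rep 1) {i : Fin 28}
    (hi : i ∈ (exchanged : Finset _)) (h : (exchanged : Finset _).erase i ⊆ K) :
    coeffRho K = 0 := by
  obtain ⟨j, hj, hj'⟩ := exists_eq_insert_erase hi h
  rcases neighbour_cases i hi j hj with h1 | h1 | ⟨D, hD, h1⟩
  · exact absurd (Subtype.ext (hj'.trans h1)) hK
  · rwa [show K = evenNeighbour from Subtype.ext (hj'.trans h1)]
  · rw [← hj'] at h1
    exact coeffRho_eq_zero_of_odd hD h1

/-- The exterior product of the basis vectors in `K` with one factor replaced. -/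
def wedgeUpdate (K : Set.powersetCard (Fin 28) 14) (p : Fin 14) (w : R28) : Ext14 :=
  exteriorPower.ιMulti ℂ 14
    (Function.update (fun p => (Pi.single (enum K p) 1 : R28)) p w)

/-- An element of `J` missing from all the factors gives a zero column in the determinant computing
the coordinate. -/
lemma coord_wedgeUpdate_eq_zero {J K : Set.powersetCard (Fin 28) 14} {p : Fin 14} {i : Fin 28}
    (h : ¬ (J : Finset _) ⊆ insert i ((K : Finset _).erase (enum K p))) :
    (extBasis (Fin 28) 14).coord J (wedgeUpdate K p (Pi.single i 1)) = 0 := by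
  obtain ⟨a, ha, ha'⟩ := Finset.not_subset.1 h
  obtain ⟨q, rfl⟩ := (Set.powersetCard.mem_range_ofFinEmbEquiv_symm_iff_mem J a).2 ha
  rw [Finset.mem_insert, Finset.mem_erase, not_or, not_and_or, not_not] at ha'
  rw [Basis.coord_apply, wedgeUpdate, extBasis_repr_ιMulti]
  refine Matrix.det_eq_zero_of_column_eq_zero q fun r => ?_
  rw [Matrix.of_apply]
  by_cases hr : r = p
  · subst hr
    rw [Function.update_self, Pi.single_eq_of_ne ha'.1]
  · rw [Function.update_of_ne hr]
    refine Pi.single_eq_of_ne (fun e => ?_) _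
    rcases ha'.2 with h1 | h1
    · exact hr ((enum K).injective (e.symm.trans h1))
    · exact h1 (by
        rw [e]
        exact (Set.powersetCard.mem_range_ofFinEmbEquiv_symm_iff_mem K _).1 ⟨r, rfl⟩)

lemma derBasis_eq_sum (K : Set.powersetCard (Fin 28) 14) (ψ : Ext14 →ₗ[ℂ] ℂ)
    (X : Matrix (Fin 28) (Fin 28) ℂ) :
    derBasis K ψ X = ∑ p, ∑ i, X i (enum K p) * ψ (wedgeUpdate K p (Pi.single i 1)) := by
  rw [derBasis_apply]
  refine Finset.sum_congr rfl fun p _ => ?_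
  have h : (fun i => X i (enum K p)) = ∑ i, X i (enum K p) • (Pi.single i 1 : R28) := by
    funext j
    simp [Finset.sum_apply, Pi.single_apply]
  rw [h, AlternatingMap.map_update_sum, map_sum]
  refine Finset.sum_congr rfl fun i _ => ?_
  rw [AlternatingMap.map_update_smul, map_smul, smul_eq_mul]
  rfl

lemma derBasis_exchanged_eq_zero {K : Set.powersetCard (Fin 28) 14}
    (hK : ∀ i ∈ (exchanged : Finset (Fin 28)), ¬ (exchanged : Finset _).erase i ⊆ K)
    (X : Matrix (Fin 28) (Fin 28) ℂ) :
    derBasis K ((extBasis (Fin 28) 14).coord exchanged) X = 0 := by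
  rw [derBasis_eq_sum]
  refine Finset.sum_eq_zero fun p _ => Finset.sum_eq_zero fun i _ => ?_
  rw [coord_wedgeUpdate_eq_zero, mul_zero]
  intro h
  by_cases hi : i ∈ (exchanged : Finset _)
  · exact hK i hi fun a ha => Finset.mem_of_mem_erase (Finset.mem_of_mem_insert_of_ne
      (h (Finset.mem_of_mem_erase ha)) (Finset.ne_of_mem_erase ha))
  -- Here all of `exchanged` would lie in `K`, so any of its elements can be removed; `18` is an
  -- arbitrary choice.
  · have h18 : (18 : Fin 28) ∈ (exchanged : Finset _) := by decide
    exact hK 18 h18 fun a ha => Finset.mem_of_mem_erase (Finset.mem_of_mem_insert_of_ne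
      (h (Finset.mem_of_mem_erase ha)) fun e => hi (e ▸ Finset.mem_of_mem_erase ha))

/-- The only way to reach `exchanged` from the second representative by replacing one factor is to
put `18` in place of `27`. The power of `i` is the sign from reordering, whose value does not
matter. -/
lemma derBasis_rep (X : Matrix (Fin 28) (Fin 28) ℂ) :
    ∃ m : ℕ, derBasis (rep 1) ((extBasis (Fin 28) 14).coord exchanged) X
      = X 18 27 * Complex.I ^ m := by
  have h27 : (27 : Fin 28) ∈ (rep 1 : Finset (Fin 28)) := by decide
  have h18 : (18 : Fin 28) ∉ (rep 1 : Finset (Fin 28)) := by decide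
  have hJ : (exchanged : Finset (Fin 28)) = insert 18 ((rep 1 : Finset (Fin 28)).erase 27) := rfl
  obtain ⟨p₀, hp₀⟩ := (Set.powersetCard.mem_range_ofFinEmbEquiv_symm_iff_mem (rep 1) 27).2 h27
  have hmem : ∀ p, enum (rep 1) p ∈ (rep 1 : Finset (Fin 28)) := fun p =>
    (Set.powersetCard.mem_range_ofFinEmbEquiv_symm_iff_mem (rep 1) _).1 ⟨p, rfl⟩
  have hinj : Function.Injective (Function.update (enum (rep 1)) p₀ 18) := by
    intro p q hpq
    by_cases hp : p = p₀ <;> by_cases hq : q = p₀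
    · rw [hp, hq]
    · subst hp
      rw [Function.update_self, Function.update_of_ne hq] at hpq
      exact absurd (hpq ▸ hmem q) h18
    · subst hq
      rw [Function.update_self, Function.update_of_ne hp] at hpq
      exact absurd (hpq ▸ hmem p) h18
    · rw [Function.update_of_ne hp, Function.update_of_ne hq] at hpq
      exact (enum (rep 1)).injective hpq
  obtain ⟨m, hm⟩ := ιMulti_single_comp _ hinj exchanged fun p => by
    change _ ∈ (exchanged : Finset (Fin 28))
    rw [hJ]
    by_cases hp : p = p₀
    · subst hp; rw [Function.update_self]; exact Finset.mem_insert_self _ _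
    · rw [Function.update_of_ne hp]
      refine Finset.mem_insert_of_mem (Finset.mem_erase.2 ⟨fun e => hp ?_, hmem p⟩)
      exact (enum (rep 1)).injective (e.trans hp₀.symm)
  refine ⟨m, ?_⟩
  rw [derBasis_eq_sum, Finset.sum_eq_single p₀, Finset.sum_eq_single 18, hp₀]
  · congr 1
    have : wedgeUpdate (rep 1) p₀ (Pi.single 18 1) = Complex.I ^ m • wedge exchanged := by
      rw [← hm, wedgeUpdate]
      congr 1
      funext p
      by_cases hp : p = p₀
      · subst hp; simp
      · simp [hp]
    rw [this, wedge_eq]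
    simp
  · intro i _ hi
    rw [coord_wedgeUpdate_eq_zero, mul_zero]
    intro h
    have h1 := h (hJ ▸ Finset.mem_insert_self _ _ : (18 : Fin 28) ∈ (exchanged : Finset _))
    exact h18 (Finset.mem_of_mem_erase (Finset.mem_of_mem_insert_of_ne h1 hi.symm))
  · simp
  · intro p _ hp
    refine Finset.sum_eq_zero fun i _ => ?_
    rw [coord_wedgeUpdate_eq_zero, mul_zero]
    intro h
    have hpe : enum (rep 1) p ∈ (exchanged : Finset (Fin 28)) := by
      rw [hJ]
      refine Finset.mem_insert_of_mem (Finset.mem_erase.2 ⟨fun e => hp ?_, hmem p⟩)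
      exact (enum (rep 1)).injective (e.trans hp₀.symm)
    have h1 := h (hJ ▸ Finset.mem_insert_self _ _ : (18 : Fin 28) ∈ (exchanged : Finset _))
    have hi : i = 18 := by
      by_contra hi
      exact h18 (Finset.mem_of_mem_erase (Finset.mem_of_mem_insert_of_ne h1 fun e => hi e.symm))
    rcases Finset.mem_insert.1 (h hpe) with h2 | h2
    · exact h18 (hi ▸ h2 ▸ hmem p)
    · exact Finset.notMem_erase _ _ h2
  · simp

/-- In the coordinate of `Xϱ` at `exchanged`, every term except that of the second representative
has either zero coefficient or zero derivative. -/
lemma entry_eq_zero_of_annihilates (h0 : coeffRho evenNeighbour = 0) (h1 : coeffRho (rep 1) ≠ 0)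
    (X : Matrix (Fin 28) (Fin 28) ℂ) (hX : Annihilates X rho) : X 18 27 = 0 := by
  have h := hX ((extBasis (Fin 28) 14).coord exchanged)
  rw [der, LinearMap.sum_apply, Finset.sum_eq_single (rep 1)] at h
  · obtain ⟨m, hm⟩ := derBasis_rep X
    rw [LinearMap.smul_apply, hm, smul_eq_mul] at h
    have h2 := (mul_eq_zero.1 h).resolve_left h1
    exact (mul_eq_zero.1 h2).resolve_right (pow_ne_zero _ Complex.I_ne_zero)
  · intro K _ hK
    rw [LinearMap.smul_apply]
    by_cases hn : ∃ i ∈ (exchanged : Finset (Fin 28)), (exchanged : Finset _).erase i ⊆ K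
    · obtain ⟨i, hi, hi'⟩ := hn
      have := coeffRho_eq_zero_of_neighbour h0 hK hi hi'
      rw [coeffRho] at this
      rw [this, zero_smul]
    · rw [derBasis_exchanged_eq_zero fun i hi hi' => hn ⟨i, hi, hi'⟩, smul_zero]
  · simp

/-- The stabiliser of `ϱ` is finite as soon as two of its coefficients are known to be zero and
nonzero respectively. -/
theorem finite_groupF_of_coeffRho (h0 : coeffRho evenNeighbour = 0) (h1 : coeffRho (rep 1) ≠ 0) :
    Finite groupF := by
  have hfin := finite_stabilizer_of_critical rho der_rho_eq_zero
    (eq_zero_of_annihilates (rep 1) h1 (by decide) (entry_eq_zero_of_annihilates h0 h1))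
  have := hfin.to_subtype
  let f : groupF → {A : Matrix (Fin 28) (Fin 28) ℂ | A.det = 1 ∧ extAct 14 A rho = rho} := fun g =>
    ⟨LinearMap.toMatrix' (g.1.toLinearEquiv : R28 →ₗ[ℂ] R28), by
      rw [LinearMap.det_toMatrix']
      exact g.1.det_eq_one, by
      rw [← map_eq_extAct]; exact g.2⟩
  refine Finite.of_injective f fun g h hgh => Subtype.ext ?_
  have h2 := LinearMap.toMatrix'.injective (congrArg Subtype.val hgh)
  exact SpecialLinearGroup.toLinearEquiv_injective (LinearEquiv.toLinearMap_injective h2)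

/-! ### Signed lists

Exterior products of basis vectors are represented by decreasing lists of indices, sets of indices
by the binary digits of a number. -/

/-- The basis vector with the given index. -/
def eb (a : ℕ) : R28 := Pi.single (Fin.ofNat 28 a) 1

/-- The product of the basis vectors in a list, the head of the list being the last factor. -/
def listWedge : List ℕ → ExteriorAlgebra ℂ R28
  | [] => 1
  | x :: l => listWedge l * ExteriorAlgebra.ι ℂ (eb x)

/-- The digit of `m` of weight `2 ^ a`. -/
def bit (m a : ℕ) : Bool := Nat.beq (Nat.land (Nat.shiftRight m a) 1) 1

/-- The indices below `n` of the nonzero binary digits of `m`, in decreasing order. -/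
def bits (m n : ℕ) : List ℕ :=
  Nat.rec [] (fun a l => cond (bit m a) (a :: l) l) n

/-- The number whose nonzero binary digits are given by a list. -/
def ofBits (l : List ℕ) : ℕ := List.rec 0 (fun x _ m => Nat.lor (Nat.shiftLeft 1 x) m) l

/-- Digits to base `32` and to base `4`. -/
def digit32 (T a : ℕ) : ℕ := Nat.land (Nat.shiftRight T (Nat.mul 5 a)) 31
def digit4 (E a : ℕ) : ℕ := Nat.land (Nat.shiftRight E (Nat.mul 2 a)) 3

/-- Insertion of `x` into a decreasing list, in continuation passing style; the number `s` counts
twice the transpositions. -/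
def insertSign (x : ℕ) (l : List ℕ) : ℕ → (List ℕ → ℕ → Bool) → Bool :=
  List.rec (fun s k => k [x] s)
    (fun y l ih s k => cond (Nat.ble y x) (k (x :: y :: l) s)
      (ih (Nat.add s 2) fun l' s' => k (y :: l') s')) l

/-- The image of a list under the monomial transformation with images `T` and exponents `E`. -/
def actList (T E : ℕ) (l : List ℕ) : (List ℕ → ℕ → Bool) → Bool :=
  List.rec (fun k => k [] 0)
    (fun x _ ih k => ih fun l' s =>
      insertSign (digit32 T x) l' (Nat.add s (digit4 E (digit32 T x))) k) l

def eqList (l : List ℕ) : List ℕ → Bool :=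
  List.rec (fun l' => List.rec true (fun _ _ _ => false) l')
    (fun x _ ih l' => List.rec false (fun y l'' _ => cond (Nat.beq x y) (ih l'') false) l') l

/-- The monomial transformation `g` is described by the images `T` and the exponents `E`. -/
def Describes (T E : ℕ) (g : R28 ≃ₗ[ℂ] R28) : Prop :=
  ∀ a < 28, digit32 T a < 28 ∧ g (eb a) = Complex.I ^ digit4 E (digit32 T a) • eb (digit32 T a)

lemma eb_val (i : Fin 28) : eb i = Pi.single i 1 := by
  rw [eb, Fin.ofNat_val_eq_self]

lemma describes_monomial {T E : ℕ} {k : Fin 28 → ℕ} {σ : Equiv.Perm (Fin 28)}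
    (h : ∀ i : Fin 28, (σ i : ℕ) = digit32 T i ∧ k (σ i) = digit4 E (σ i)) :
    Describes T E (monomial k σ) := by
  intro a ha
  obtain ⟨h1, h2⟩ := h ⟨a, ha⟩
  dsimp only at h1
  refine ⟨h1 ▸ (σ ⟨a, ha⟩).isLt, ?_⟩
  have := monomial_single k σ ⟨a, ha⟩
  rw [← eb_val, ← eb_val, h2, h1] at this
  exact this

lemma ι_mul_ι_comm (v w : R28) : ExteriorAlgebra.ι ℂ v * ExteriorAlgebra.ι ℂ w
    = -(ExteriorAlgebra.ι ℂ w * ExteriorAlgebra.ι ℂ v) :=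
  eq_neg_of_add_eq_zero_left (ExteriorAlgebra.ι_add_mul_swap v w)

/-- Each step past a larger head is one anticommutation, recorded as `2` because `i² = -1`. The list
need be neither sorted nor free of repetitions: anticommutation holds for all factors. -/
lemma insertSign_spec (x : ℕ) (l : List ℕ) : ∃ l' t, (∀ s k, insertSign x l s k = k l' (s + t)) ∧
    Complex.I ^ t • listWedge l' = listWedge (x :: l) := by
  induction l with
  | nil => exact ⟨[x], 0, fun _ _ => rfl, by simp⟩
  | cons y l ih =>
    cases h : Nat.ble y x with
    | true =>
      refine ⟨x :: y :: l, 0, fun s k => ?_, by simp⟩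
      change cond (Nat.ble y x) _ _ = _
      rw [h]; rfl
    | false =>
      obtain ⟨l', t, h1, h2⟩ := ih
      refine ⟨y :: l', 2 + t, fun s k => ?_, ?_⟩
      · change cond (Nat.ble y x) _ (insertSign x l (s + 2) fun l' s' => k (y :: l') s') = _
        rw [h, cond_false, h1, add_assoc]
      · have h3 : Complex.I ^ (2 + t) • listWedge (y :: l')
            = -((Complex.I ^ t • listWedge l') * ExteriorAlgebra.ι ℂ (eb y)) := by
          rw [pow_add, Complex.I_sq, neg_one_mul, neg_smul, smul_mul_assoc]; rfl
        rw [h3, h2]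
        change -(listWedge l * _ * _) = listWedge l * _ * _
        rw [mul_assoc, mul_assoc, ι_mul_ι_comm (eb y), mul_neg]

lemma actList_spec {T E : ℕ} {g : R28 ≃ₗ[ℂ] R28} (hg : Describes T E g) (l : List ℕ)
    (hl : ∀ a ∈ l, a < 28) : ∃ l' t, (∀ k, actList T E l k = k l' t) ∧
      ExteriorAlgebra.map (g : R28 →ₗ[ℂ] R28) (listWedge l) = Complex.I ^ t • listWedge l' := by
  induction l with
  | nil => exact ⟨[], 0, fun _ => rfl, by simp [listWedge]⟩
  | cons x l ih =>
    obtain ⟨l', t, h1, h2⟩ := ih fun a ha => hl a (List.mem_cons_of_mem _ ha)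
    obtain ⟨l'', t', h3, h4⟩ := insertSign_spec (digit32 T x) l'
    refine ⟨l'', t + digit4 E (digit32 T x) + t', fun k => ?_, ?_⟩
    · change actList T E l (fun l' s => insertSign (digit32 T x) l'
        (s + digit4 E (digit32 T x)) k) = _
      rw [h1, h3]
    · have hx := (hg x (hl x List.mem_cons_self)).2
      change ExteriorAlgebra.map (g : R28 →ₗ[ℂ] R28) (listWedge l * ExteriorAlgebra.ι ℂ (eb x)) = _
      rw [map_mul, h2, ExteriorAlgebra.map_apply_ι, LinearEquiv.coe_coe, hx, map_smul,
        pow_add, pow_add, mul_smul (_ * _), h4]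
      change _ = _ • (listWedge l' * ExteriorAlgebra.ι ℂ (eb (digit32 T x)))
      rw [smul_mul_smul_comm]

lemma eq_of_eqList {l l' : List ℕ} (h : eqList l l' = true) : l = l' := by
  induction l generalizing l' with
  | nil => cases l' with
    | nil => rfl
    | cons y l' => exact absurd h Bool.false_ne_true
  | cons x l ih => cases l' with
    | nil => exact absurd h Bool.false_ne_true
    | cons y l' =>
      change cond (Nat.beq x y) (eqList l l') false = true at h
      cases hxy : Nat.beq x y with
      | false => rw [hxy] at h; exact absurd h Bool.false_ne_true
      | true => rw [hxy] at h; rw [Nat.eq_of_beq_eq_true hxy, ih h]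

lemma bits_succ (m n : ℕ) : bits m (n + 1) = cond (bit m n) (n :: bits m n) (bits m n) := rfl

lemma mem_bits {m n a : ℕ} : a ∈ bits m n ↔ a < n ∧ bit m a = true := by
  induction n with
  | zero => exact ⟨fun h => absurd h List.not_mem_nil, fun h => absurd h.1 (Nat.not_lt_zero _)⟩
  | succ n ih =>
    rw [bits_succ, Nat.lt_succ_iff_lt_or_eq, or_and_right]
    cases h : bit m n with
    | false =>
      rw [cond_false, ih]
      refine ⟨Or.inl, fun h1 => h1.elim id fun h2 => ?_⟩
      rw [h2.1, h] at h2
      exact absurd h2.2 Bool.false_ne_true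
    | true =>
      rw [cond_true, List.mem_cons, ih, or_comm]
      refine or_congr_right ⟨fun h1 => ⟨h1, h1 ▸ h⟩, And.left⟩

lemma pairwise_bits (m n : ℕ) : (bits m n).Pairwise (· > ·) := by
  induction n with
  | zero => exact List.Pairwise.nil
  | succ n ih =>
    rw [bits_succ]
    cases h : bit m n with
    | false => exact ih
    | true => exact List.pairwise_cons.2 ⟨fun a ha => (mem_bits.1 ha).1, ih⟩

/-- The set of indices of the nonzero binary digits of `m`. -/
def bitSet (m : ℕ) : Finset (Fin 28) := Finset.univ.filter fun i => bit m i = true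

lemma listWedge_eq_prod (l : List ℕ) :
    listWedge l = (l.reverse.map fun a => ExteriorAlgebra.ι ℂ (eb a)).prod := by
  induction l with
  | nil => rfl
  | cons x l ih =>
    rw [List.reverse_cons, List.map_append, List.prod_append, ← ih]
    simp [listWedge]

/-- `listWedge` multiplies the head last, so the decreasing list of digits yields the product in
increasing order. -/
lemma coe_wedge {K : Set.powersetCard (Fin 28) 14} {m : ℕ} (h : (K : Finset _) = bitSet m) :
    (wedge K : ExteriorAlgebra ℂ R28) = listWedge (bits m 28) := by
  have h1 : (bits m 28).reverse = (List.ofFn (enum K)).map Fin.val := by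
    have hs1 : ((bits m 28).reverse).Pairwise (· < ·) :=
      List.pairwise_reverse.2 (pairwise_bits m 28)
    have hs2 : ((List.ofFn (enum K)).map Fin.val).Pairwise (· < ·) := by
      rw [List.pairwise_map]
      exact List.pairwise_ofFn.2 fun i j hij => (enum K).strictMono hij
    refine List.Perm.eq_of_pairwise (le := (· < ·)) (fun a b _ _ h1 h2 => absurd h1 h2.not_gt)
      hs1 hs2 ?_
    rw [List.perm_ext_iff_of_nodup (hs1.imp fun h => h.ne) (hs2.imp fun h => h.ne)]
    intro a
    have hK : ∀ i, (∃ p, enum K p = i) ↔ bit m i = true := fun i => by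
      have := Set.powersetCard.mem_range_ofFinEmbEquiv_symm_iff_mem K i
      rw [Set.mem_range] at this
      rw [this, ← Set.powersetCard.mem_coe_iff, h, bitSet, Finset.mem_filter]
      simp
    simp only [List.mem_reverse, mem_bits, List.mem_map, List.mem_ofFn, hK]
    exact ⟨fun h => ⟨⟨a, h.1⟩, h.2, rfl⟩, fun ⟨i, hi, hia⟩ => hia ▸ ⟨i.isLt, hi⟩⟩
  rw [listWedge_eq_prod, h1, List.map_map, List.map_ofFn]
  change (List.ofFn fun p => ExteriorAlgebra.ι ℂ (Pi.single (enum K p) 1 : R28)).prod = _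
  congr 2
  funext p
  simp only [Function.comp_apply, eb_val]

lemma coe_map_wedge (g : R28 →ₗ[ℂ] R28) (K : Set.powersetCard (Fin 28) 14) :
    (exteriorPower.map 14 g (wedge K) : ExteriorAlgebra ℂ R28)
      = ExteriorAlgebra.map g (wedge K : ExteriorAlgebra ℂ R28) := by
  rw [wedge, exteriorPower.ιMulti_family, exteriorPower.map_apply_ιMulti,
    exteriorPower.ιMulti_apply_coe, exteriorPower.ιMulti_apply_coe,
    ExteriorAlgebra.map_apply_ιMulti]

/-- Whether the transformation described by `T` and `E` sends the exterior product encoded by `m`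
to `i ^ t` times the one encoded by `m'`. -/
def sends (T E m m' t : ℕ) : Bool :=
  actList T E (bits m 28) fun l s => cond (eqList l (bits m' 28)) (Nat.beq (Nat.mod s 4) t) false

lemma map_of_sends {T E m m' t : ℕ} {g : R28 ≃ₗ[ℂ] R28} (hg : Describes T E g)
    (h : sends T E m m' t = true) :
    ExteriorAlgebra.map (g : R28 →ₗ[ℂ] R28) (listWedge (bits m 28))
      = Complex.I ^ t • listWedge (bits m' 28) := by
  obtain ⟨l', s, h1, h2⟩ := actList_spec hg (bits m 28) fun a ha => (mem_bits.1 ha).1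
  rw [sends, h1, Bool.cond_eq_ite, Bool.ite_eq_true_distrib] at h
  by_cases hl : eqList l' (bits m' 28) = true
  · rw [if_pos hl] at h
    rw [h2, ← eq_of_eqList hl, ← Nat.eq_of_beq_eq_true h, ← I_pow_mod s]
    rfl
  · rw [if_neg hl] at h
    exact absurd h Bool.false_ne_true

/-- In these numerals the images are base `32` digits placed at the source index, and the exponents
base `4` digits placed at the target index. -/
lemma describes_permV : Describes 0xdc1f1735895a8e64148300839c6af6aca93 0 (coordPerm permV) :=
  describes_monomial (by decide +kernel)

lemma describes_permF03 : Describes 0xd9d0621461102117b5cc52d39d62d7ace92 0 (coordPerm permF03) :=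
  describes_monomial (by decide +kernel)

lemma describes_permN356 : Describes 0xd9483d670b52693939ac41cd183c4105ed5 0x55555555555555
    (monomial (fun _ => 1) permN356) :=
  describes_monomial (by decide +kernel)

lemma describes_permM : Describes 0x646d8a647754b474b5db14de581901aac80 0x94f14f02f14f14
    (monomial expM permM) :=
  describes_monomial (by decide +kernel)

/-- `F_{03}` followed by `V` maps this set to itself and reverses the sign of its basis vector. -/
lemma coeffRho_evenNeighbour : coeffRho evenNeighbour = 0 := by
  have hK : (evenNeighbour : Finset (Fin 28)) = bitSet 998126 := by decide +kernel
  refine coeffRho_eq_zero_of_map (mul_mem coordPerm_permV_mem coordPerm_permF03_mem)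
    (c := Complex.I ^ 2) (by norm_num) (Subtype.ext ?_)
  rw [coe_map_wedge, Submodule.coe_smul, coe_wedge hK]
  -- `998126` encodes `evenNeighbour`, and `91969029` its image under `F_{03}`.
  have h1 := map_of_sends describes_permF03 (m := 998126) (m' := 91969029) (t := 0)
    (by decide +kernel)
  have h2 := map_of_sends describes_permV (m := 91969029) (m' := 998126) (t := 2)
    (by decide +kernel)
  have h3 : ((coordPerm permV * coordPerm permF03 : R28 ≃ₗ[ℂ] R28) : R28 →ₗ[ℂ] R28)
      = (coordPerm permV : R28 →ₗ[ℂ] R28) ∘ₗ (coordPerm permF03 : R28 →ₗ[ℂ] R28) := rfl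
  rw [h3, ← ExteriorAlgebra.map_comp_map, AlgHom.comp_apply, h1, map_smul, h2, smul_smul, ← pow_add]

/-! ### A finite set of vectors stable under the monomial group. -/

/-- The orbit of the second representative under the monomial group: `3024` words of `30` binary
digits, encoding four times a set plus the exponent of a power of the imaginary unit. -/
def orbitTable : ℕ :=
  0xffb0c403fe40518ff85a203fe040acff68a80bfd80316ff43608bfd08078fed87003fb2060efec6c103fb100d4fddb080bf7406a2fdc5a04bf702078fcb450abf2c8c90fcac834bf2a30e2fca106bbf278702fc781b03f18d920fc4a8e2bf124b44fc47145bf11a552fc2ca64bf0a39a0fc23147bf08a55afc076263f00a8eefbf61003ef80560fbc36013ef008d4fb351c0becb1124fb29854bec648a4fb18a383ec2827afab8168bea50e30fa925a2bea3b242fa870c33ea14b84fa196893e863a62fa0e0c7be830b94fa07c0d3e8118faf9b07c03e6ac01cf9a9225be671492f99a30a3e622278f92645cbe45343af8f8186be38d904f8d4362be349530f8c4ad43e303b60f8ab4983e2ab10ef8a570c3e28c368f89446d3e248adaf88eb22be22332ef8527233e12caaaf7ed040bdf203c0f7c6c02bdf010aef7380d83dc92532f7215513dc56c80f707186bdc0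d628f67241a3d9c18e0f66b1c03d968a86f6598923d9504d6f632d12bd8c3cc0f615187bd84562cf607a13bd8070f6f5780c33d556c12f54a991bd524e88f542d4abd503da2f525871bd426a54f4f50073d3d205af4ea2923d3a6286f4e046bbd362f02f49332a3d229a8ef475268bd1c5c16f463c913d181d96f456aa23d1545a6f44a3363d12616ef3b8145bce92346f3a14cc3ce3b208f3817a1bce03ec0f374454bcdc6124f368dc03cd7801cf35a40b3cd40cd4f32452dbcc8626cf31e930bcc72a1af31564cbcc42e58f30e1b43cc2f146f2a4c4e3ca59470f261a55bc9362c4f1af0863c6b4a90f1895a93c6236e2f186e2c3c61507cf15f105bc56d426f15295abc542de0f145e19bc50e0dcf0f7043bc3da148f0e42f4bc381be2f0c622f3c30f8caf03e9703c0f4ba2f03cac6bc0ed662f03ad43bc0e5e16f03742e3c0d3874f0331da3c0c2f58f02f81dbc0b87d2f029e333c0a1f96f01f233bc0747a4f01ae2e3c06372ef0067ba3c019d3ef005d7c3c01735ef003ba7bc00ebe6eff0c013bf6c040efc11583bf0260eef2b038bbc9a304ef2530a3bc50598ef0d449bbc1af00ee7802d3b9a22a4ee5c720bb9492d0ee4a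872bb91c362ee38643bb89b184ee1c02f3b8322acee08dc6bb81bd80ed900db3b6046d8ed8096dbb4a84eaed0a257bb4265a6ec9296c3b23872aec8a4a73b0e07c6ec31c36bb06e5a0ec15ac3bb01c3f0ec00fcebb003ceeeaf56103abaf400eadea013aae91a0eaa4e4abaa78c24ea5e851ba95d320ea49e4c3a8f6700ea3a607ba8bc8e2ea28d353a878564ea17c07ba815e4ee9a247cba681f28e9915a6ba5cc076e970b85ba58e264e95f2603a55d888e95331cba5305f2e94453e3a50ee62e93cc623a3e921ae8f47123a33ca2ae8aa535ba256b2ae84c5e3ba0b8ce8e81f037ba05d3b2e805f78b9ce1946e70943d39ad3a10e6a03a739a745c0e698c33b9a5b830e694d2339a2714ee685d43b9a08cbee6499c63991e94ae63de80b98807dee61fe08b98085fee5e8c07b978aa48e5d03acb9732c2ae5c96d0b9715f00e5a850f396912e4e5a1996395f8246e562837b9492772e522fa139456b44e50f554b9424f8ce4bb28cb91f90c4e45a33c39153e8ae441bce3909335ee3f803638fd8c10e3e905638f85236e3d246538f03b0ee3619e8b8d17a26e33a61538cd149ce31734c38c167a8e2f1691b8b9e288e2d2ec238a88f70e27cc5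4b89eca84e27488fb89a64d4e25927ab88a7a8ce1fe098387c08f8e1e31e8b8784978e1cb694b871de10e1b81d5b86c7618e19b82db8656b62e1871eab861c47ce180ee7385fe902e177e02385207f4e1405bfb842cbe4e0fe438b83e6f00e0f0793383b381ce0eb135b834f8e2e0c6b59b82c38f6e0ac70fb824bb9ae087b87b81be172dff6020b7fa280adfc20f037f00d1adeb801bb7ac7120dea492937a60c6ade942acb7a1c6c0de610cdb79780e2de53892b7934e08de4b45437915f02de38c86378c407cde1131e37842f14de0da8ab7817b22dd330e8374c28b8dd29f0137497844dd21a4e3744aa9add0854f3741117edd03ac6b7248f14dc876a4b71e3288dc5283b370efc02dc37e10370207bedc040ffb6d806dadb4216d36d00b6edb242d936c54750db1490f369701f0da544a7b6948b6ada381ea368d8b60da2aa2db688de1ada071b936803f54da00e7eb6781564d9d8a073674b680d9d1654b6731c90d9c3dc03656215ed94a365365264e8d93e511363f4488d8cc22f362f60aad8b4479b6287d32d8827d5b618de8ad8578e1b614973ad84cf4a36124fc4d809ba7b5ed5808d7abc2035e7a900d73c898b5cd514ad709e94b5ad4a88d6a799035a4ba44d63cc07b58ecf02d6350f23589e81cd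61f438358629acd603d66b57e00b6d5ed441b579222cd5da0a5b572a44ed5c0f86356ab48ad5a4f84b563cc32d50c5f1b5328f60d4c3f12352f942ad4b9aa1b52c92f0d4a9317b52689acd47cc23351a613cd4674d13510cf72d41af0e34ef2416d3a9c6434e5d450d36294db4d322e6d348dd434c8de50d31c86bb4bdd220d2ee033b4ba1d0ed2e7c0c34b991c6d2d10f934b38cc8d2c6770b4b061f6d2919ce349e6a30d23702fb489e666d21d47cb480fbe0d1fd130347a10f6d1d6d2134738762d1ca4b53471f504d1bd838b46e9f00d1a8d66b469b8e0d19e06bb466781cd1856f2b45e078cd17621bb45aad14d1637b0b451c770d14707734503e3cd128e3b34493e36d119c57b441dd1cd0ff680343bf812d0d01fbb43025fcd09f2b1b41596eacf75007b3d9620ccf5685433d3924acf44366b3d0f0e2cf1954a33c2995acef1c09b3b49168ceca89cb3b22ca8cec7036b3b03da0ceb48e433a4b256ce75560339c45b2ce69c52b3972a50ce5560db394a698ce4a4cbb39119b4cdf06383378b42acdd26b033733248cdc6a0733705566cda43d4b365226ecd8630f3347d446ccef0943333231eccba2a9b32c72d0cca49b9b32491facc8ce5c331bcb12cc61e5ab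31434eccc4b5c933092adecbbe888b2eeb212cbb3143b2eca548cbb1361b2ec2dc0cb8c1dab2e2175acb83a3332d892d8cb515ca32d071f2cb0f68c32bf2192cad7426b2b2f450ca8c4bd329aa9b2ca55593b28f861eca3a4eab28a3f60ca1d9d4327b0d52c9cd91a32637a30c96ce62324a57a6c9254f932470f96c9147a73243a2eec90acb7b239bc28c8e4cbcb2367952c8ccb5932325f8ac8aa6b93228e9ccc89f0b5b2236e1cc889eeab21f868ec871b8d321b28dec864eec32157786c81c77a3203b770c7f622431f92458c7cb055b1f2a23ac7c7145b1f0386cc7ba509b1e93866c78ea4ab1d63a2ac74a5b8b1cbcc2ac717c5431c5923ec70d3d131c2d59ac6a22fc319f0ad2c667a46b19616e4c6569273182fc2cc5f4741317c0d34c5eb48ab17958b0c5e28d9b1778c4ac5cc9b4317154b4c5a46f2b166e434c566077b1567e20c55731631532f90c538cf1314ccbb0c5267e1b146d0ecc51758db13e522ec4ec0e73138b1e4c4d3f18312e4c74c4ac67cb12755c4c49b3c6b121ebd0c47d389311e5b90c47751cb11d3938c46c3e9311995f2c465f2331186cbcc4595e53115d9c6c454d4f3114c9f6c3f258930f9a2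aac38c4afb0de6294c37628bb0d9247cc3524e7b0d3d43ac328eabb0c7629ec313b33b0c3ce54c30b6f8b0b4663ec2bd3a4b0ae5b26c2a9e4db0a7ccb2c28fa9ab0a2fa58c27926eb09b1d8ec269bd83097543cc243f8b308f9278c2378cd306f2656c1b8cf8b06a9f28c19f1c6b054d2eec12d557b043b738c0cfa74b02f3278c0b2facb00feb14c03bfa8300cedccc02d1f730061feebfed0082ff61810bfc41a82ff01314bf380362fcc11d0bf2aa90afc85466bf0925a2fc1c5a2beb5038afa98c90be968a1afa4d512be8a193afa0f702be38b05af8a80dcbe224752f881f0ebe137142f80fe42bd756802f5af010bd5ea082f4ad432bd24f22af43cd80bc793302f1ae290bc52f212f0f9700bc39a07af0de0e2bc3069eaf0ac6b0bc0f6072f01ab36bb245c3aec1f426bab8b0caea908f8ba6e1982e9a1874ba6470dae96b90aba508d7ae92f88aba4a6952e919e16ba418b7ae8fb902ba2fe20ae84077cba011bfae7e006cb9f410bae76e208b9d42662e724c5ab9c0f45ae6517c2b986e64ae572932b957451ae527d04b93d854ae4e9c2ab93449e2e4b24e4b91a467ae2e6838b89a2972e23e68ab8865f12e1467aab834e552d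b205b6b6c40db2db016d8b6b10b92da916d2b6a190fad98c786b6612572d9256c8b6381dcad8b56c0b61c61bad83b516b60717aad803f8eb600ebd2d6be440b5a21baad6740bab598cc62d6551b2b58fa112d6362a8b585ce8ad608aeeb5792432d59e184b55aa892d488f54b4d133aad342f86b4cc2d3ad2e9c44b47129ead13b584b4338b9ad0bc07cb40f372ad01bee2b3f06072cf92d22b3e2ca12cf47126b3c88f22cf1af00b3bb04c2ce4507cb33b21c2cca62eab30aed1acc1378eb2f02a7acb5132cb2d227c2ca9ce28b2a49d5aca497a8b291ed42ca3b532b27d8622c849d3cb1fb068ac79692ab1d883b2c7547c2b1d492bac71eb0ab1bfd00ac6807f8b19fe01ac600bfcb17cdc02c5ec8e0b17509eac5cb81cb158acdac5378e2b143dacac4dd4aab0f81ce2c3b50dab0dc6c32c33b5a2b0c71f12c31c2beb0c0f57ac2965f0b072aa7ac1638f8b049f532c11f31cafa32492be7801eaf96445abe2d42aaf85638abe0a64eaf6146aabd832c6af5c6242bd24ca4af4701b2bd03ec2af347092bcab128af21365abc78e40af1c1b2abc3a898af094d32bc0acdaaeac3a12ba86c2cae5a552ab925938ad9125b2b630f8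4ad8473aab5e944aad6568aab53c84ead31d32ab438b34acfb4602b3e5908ace21e9ab380f2cacdd185ab372652acd95892b363662acc5c1d2b29e988ac6227e2b0ec31cac393712b0c3fa2ac2e5caaaf94438abe14632af6e04aabd248baaf1c618abc0e2daaea3984aba12f8aacea168ab282fc2ac5f40eab0b497aabe4a90aae3d21aab4b8b2aab78a1aaa9a730aaa53932aa3dc2aaa8b2672a9465e8aa25ea5aa764b90a9d34712a6f1158a9a72a32a66e196a9924af2a624d5ea94c4e72a4f24cca934de8aa4cae56a92e2a72a417b94a8e22772a2c39d4a8ae457aa29e33aa8a5b782a237274a87e8d22a1f2d92a874f26aa1be2caa867c69aa19792ea83b26baa07d598a7e264929f628e2a7d16a1a9f26962a7c43aca9f0f01ea77704a29d8951ea737942a9c94f92a714f2929c21af6a6d29caa9b291b6a6c38a729abca30a6798742998bcaaa65c65a299493f2a64933ba984b17ca5f298aa97992a4a5b2f11295b3c2aa564bd1a958b6b0a553ea1a95499e8a53b0d5294cb07ea51cce62944bdc8a50e7d42939b98aa4b43f4a92aa75aa4a347d2928597ea49637c2922ab5ea471a7c291bc17aa466cc729193dc6a455d1da90aaee6a4237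eaa8fd4986a3eb88928f89368a3dab8428f62698a3d6a32a8f455b2a3c62b6a8eb3b80a3a2dd228e4c47ca38f88ba8df0996a372157a8d45cf2a34dea8a8cfa392a33cb5228cca7d0a32c3d628c7caa8a31af2328c5ba54a314cb728c4cee8a30fb1c28c364faa30a7a7a8bb529aa2d2b59a8ae1d72a2ad23da8a765caa293bd428a3cb98a27c8ae289caceaa26e39ca89b670ea247d5a286349f4a167d1aa83e9338a0f8778283c6f84a0ef1c3282d8e3ca0a37e3281e99aea059ef2280ff51aa03def0280d877ca028bfd280776749faaa12a7e922d09f94331a7e419709f8702da7e03b609f29389a7c92c8e9eeb00727b94a849ed5924a7b2cc189ec6a38a7b053349eb1721a7aae3229eaa0d927a90d349ea3c13a7a6aa929e94996a7a0726c9e728d4a79532949ded4092775828c9dd4315277249969dc70c3a77038d89d7c85227555a509d49e32274316e49cf0f14273525e29cb9529272c25ea9ca524fa723da169c67aa1a719645c9c5f4542715a3369c535e2a705b9589be8c3826f934a09bd1b2426f329529bc5607a6f0a3ca9b9f12126e44e1c9b61336a6d257869b45457a6cf146a9b2ab2926c922f69b11eb1a6c24dea9aa0a7e26a7d6069a969d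2a6a2bad09a7786226825cbc99f5464267a730899e84d3a677a45099d136926730eca99cbc192670e16e99ba916a669b9c0999918fa6632aea9976253265276b2993a473a64d971499338eaa64672e499077a9263cbd4098e746526345f2498cd0af262ed54898bad89262ca72e98af871262a7a5498a7caa262992ec98a1ad726265768988d8f9a622f93a988a65f261e2ea8987683e261b96649867953a613772897b928925e9e0369796a6125df4c40977cb0125db831a976c2e425da932a97686e825d447d297509e525d198b8971193b25b8a75096cc92d25b0aae496a396625a71a669657d11a58f451c963c99ca58ccf849618ff0257b254895cd31ca5688d5c955191fa54ed526953ad92a54dd164951ae93a545dcd09516f25a53e8c2c94ed5162539263c94d7855a53249de94ba49da52ce15e949a7f02526733a9486f56a51ccc3c946666ea5163c7a94575632515b6e2943d935250bce4c93d94e1a4f4c9d293b2ea1a4e4b73293916f224e379529389b3924d4fc44933712ba4c734ea9313747a4c4be70930e6ae24b67a3092bd14ea4aa9d4c92a3bcaa4a658bc9289f99a49c572c9261d4fa496a76a925533e24952cbe924b9baa48c73f29215bf12465daa69179363245e2ee291771c5a45737509139b35244b3d6490e693e2416e39c9055bd5a40fde0c903ef58240c37fa902e6ee2406c7be8fbe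01323ed91468fb038723ea3d048f9235ca3e0af628f7d02623db62888f68547a3d913c68f58ec2a3d11fc28efb00da3bc3e108edb30ca3b6231c8ec99aaa3b077a28e3e985a38f4d0c8e3b4c6238dd5c28e3317c238c2fa68e30ab7238be3a08e2e0f9238a1f688e2872fa389f0cc8e25f852387ce608e1d1ba238637d28e18c5fa385d8768e16ec62383e8b88e0bf43a38199f48e05cbb2380ecf88df8619a37bc6408ddc17823769a448dd45a3a371570c8db818fa36e05e88db1db0a366e5168d95a1b2361c2f68d80e77a35bcf008d68dac2359b81e8d5e0cda3567f028d57c3823515a788d38c1fa3499c3e8d09e7323417f168cffc20a33f780a8cc21fda3300f7e8c9a5f4231fa6848bf8c3222fd348a8bf10f822f8653a8bdf160a2f0e7188bbfa08a2eef8128b841fba2e017dc8b7815722de03f28b762c3a2daada28b6363622d1c4ec8b40eaf22cd27a48af5193a2bcbf028ae7a38a2b7d7028ad8b5922b3781c8ac3d3522af4d2a8a78a37a294bab88a4dc57a290ff0c89b25e5225f80fa8955c7c2253cccc89477e8224b547c891c67ea23f2e288853ef22213dd98883fa2b220dfbc08833b9d220b46fe8806dfd21fe28b287f70c8a1fa8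6e087e9a4c21f28b5487c63c521ede70087b06f2a1eb3f0287ab166a1e4f81c878f638a1e1a9ac877f61021dfb80687411fea1d027be873b4d421be06e686f80e7a1bb561a86dc6d8a1b3b0b486c707e21b03c7e86b862f21a93c768693aa721a1bf1a86693daa16ec0ec85a789d21639ce88587bf0a15eb3848527b9321437d6484d93d6a12d8abe84aab3ba10ff0d684360ffa107fd62841dcee2100dffa83b975420db272e82fd03d20b8eae682d746e20b1f76082a6faca0a5f3348271cbd2096e1dc823f61e208bfea0822e7732086c5fc8205bfba07f2e6081face8207e5dc081f4f43a07cc79681f30bb207c2d3e81ee1cba07b84fa81e9ec6a07a1b5c81e7d98a07978ba81dd1d6a07741f481daf85a076369e81d76e82075b8ce81cfb70a072f87481c66b7207174bc81c3a5fa04ef8d48137f83204cebb881186ffa041b7be80bde1e202a2dfc809fec5a02775cc80837f7201fb8ac8070dbfa01bfd18806e79d20116f7c7e312ca1f8a96527e2386c1f8725867e155321f838a667db05a11f6853327da0d259f6685527d8b1349f62a38a7d819ca9f5e48307d723241f5c61247d6c9a09f5693047d4e9281f52b1167d308979f47483a7d14ec41f406e6a7cb44ca1f1c4b447c2279c1f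07618c7b740e11eda25287b560691ed50e327b4a9919ed2292e7b423d49eca66507afa4111ebd26087aec4499eba8a4a7ad93489eb549607ad4a839eaa96887a734151e9a0c9e7a61f819e909dd07a3328e1e8335c4799a2ca1e5c82ea796961c9e59d62079432d61e4a25b87926a5c9e4685767913d0e9e43587a790b13d1e4229bc78ea54c1e2ef09078a57349e254ada7894a6d1e23ac9678843db1e179b04785bb481e15e960785271b9e13b916784b2ad1e10d9da780dc731def208a77b24d09dea4d1277a34b01de85c1a779c5249de6624a771c94c9dba462a76e509a1db8554476d82d41db50d8876d06961db1178676ae8239da6113e768af429da133a6765a3619d8b94567611aea1d6d28aa75990791d65cb82758594b9d5c4e8a752dda01d4aed1275258769d48fc18750fd281d426ab47505b1b9d3a658474b05b39d2a46ba74a6a2b1d2942f874a0d371d24f4aa748d6a31d1f584a7463c969d15aa6a744e85b1d12b4da74429ed1d099c74739c8d11cdd1652733ea099cc8d4b4732169b9cc5592c730bc699cc057d872ec13c9cb6b0c672cf9501cb1969472b66d01cad760a72a76b09ca931da729651b1ca57a0e7286cad9c9d03ce7266a559c960b74725607b9c94f0d6725069f1c935ac67213aae9c7c4e5071ea5611c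79194e71dc8ca1c74ac3671c9ca69c6c6a72718e5631c5a9cc471558ce9c439ccc70e33951c3731aa70a3a9d1c1571b86f9a0c91be50cc46f9093a1be2c2a46f8a8721be149706f84a4d1bc94cca6eea9489bb9a1606ed75011bb564926ecd4499bb2c8d06ecaa259bacd40e6ea1e319ba4366a6e858979b9552d26e338669b831e646df04d21b7852346de0c561b750c546dd110f9b714ac86dc4aa39b5c27906d54e859b4dc1346d322571b4b234c6d165361b423eca6ce1e151b3161e46cbd1259b2a4b2c6ca68b61b23529c6c82eda1b1f50586c772831b1d223c6c659171b16c19e6be95829af950d06be4c259af8aa4a6bd2f101af46c926bc96831ae3e0c46b81a979adf0e066b60b271ac8be866b20dbc1ac47ac46b0cf581ac05fca6aab40f9aaab3506aa56a91aa939c86a94bf01a9d511c6a69ce11a955ca86a4abb81a927e3269dad189a74c52c69cf8151a7069e669b8b349a6b236869a2a7c9a6259b669874cb1a4ef18a69320fb1a4672e4690769b9a3ad38668eac3a1a354f1668cf28d9a33a95a68bf1619a2ed54a68bad891a2e3e5068b6ca61a2ca72c68b13c71a291eac689c9f81a26d9b268995da1a238d78686fd889a19e54c6863c3e9a13176c6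7991e499e5c9c2677289599dc4c36676644e19d919b06761b8919d724c8675947119d555866752b9419d38a98674d95299d29aa866fc35019b344f0661d32799853dd265ccb0d996a4b6465a714d196712e46598eb219649cb66536d16194c4f8c651c9dc1946dca664e73831935e15664cf5549932c59c64c69cd192ef23264b38571926137c6486e5b991fad4064709f6191b8b9a646a6ea1916b4f06454f9a990e74e4643197b1906f788641a5f3990579d863d2a6598eea8a463b0cbc98e73960639927a18e26ce6633d78198ccd49c632e4ce98cb1bb063191ed18c5cd2c62eb8d498b9e58a62e554798b6aae062d6b0e98aafd0862a23db18a2f0bc6289f99989f3650627b3619895a57862517ab188f7528623c55b1887f64462179d318835cde61e6353187672b26174b3c1855ce94613b917984cf73061325dd1846667e6117aad981eee2a607a39b981cfd466066b3d98147f665fa784297e8c9265f9c2d017e590a45f9460b17e4e24a5f8d2b017dd06485f6146a97d809f05f5611a97d50ab25f434b197d05a4c5f2e84697c82dd05f0ae2a97c0cc9e5ea39291792d1b05e2e28d178475c85db94e01764c1e45d721c99759d2a05cf28aa973c49b25cec323973a914e5ce47611738e32a5cd550d173534725cd32e4973362545cca752173272665c3344f97087ba45be89a496f8815e5be146396f2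a44e5bc8aa516f0d4b05bc170e16e2b88e5b832ba96cec12e5b1a59696c4e43e5b0d32d96c13ed05ae83c916b87c0e5abb82516ad823e5aaf50696aa4c5e5a8b267969bc24c5a6c4a7969961b65a593a696943db259d16531669ca8e59978e19665833c598f54616614f4e597193a165c3cb25964c5b965696ca594f0d3164fac4659309b7964b8a9c5905eb6962f5b8058b4a79162a0fb458a1f7496275636589cd9c961db16a58713f1961b6996586a5ce160ea9e85836bcc160d27ba582a2fe9608fab457e4e6015f8992457da94495f4b41857cc72415f2e0a457c9a0b95d5c8a8574272795c85fa0571e81715c72e84570bd1a15c27ab256f954295b2193c56ab88715a8f170569ab8a15a51de05692f511598bcaa5651ef095933d285648b791590b7b055e468b156d1ce055a565595678e86558f2cc9562e31c557c61a155c92f05571eb0155a2ce6555267a1547bb125516a1f9544bdca550c5f6952f932a54b9b6195294bd454a2d5e951ef50854721db951ba13c54674d6151766565459d99950eeb5054398f6150ded8a54273e69504f1bc53f4a7094f9835853d722314f09aea53a35c314e7a62a539ca3c94e5d44e53956a594de19a653593b494d4b26e534c6b914d1e658533f0ca94cfa392533cb5294ce3d845336c9994cca7d253313f894cb6c36532c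3d614ca971c53154f514c2757a529fb5094a467da528f2e614a3a8f4527ea8c949cace8526c1be1491f4d851f2b191473539a50e96791439d52c50be754142f15da50aeee21428bfc8508d67b941f899c5072377941baf46506c9f39419dc6e4fb947093ec24b84fa5d4293e4c7904f5686c93cd074e4f3265693cb35184f19b4a93c5856c4f052de13c12b3c4ed545a13aead224eb6a5893ad238e4eb0d8e93a7b0a64e9ce0b93a4b5564e77682939aa6984e69d9213972a4c4e4aacb139225f64e2c78d9378b4344dbc12d1368cf524d965b413625d364d83ed2935f107a4d7a2a9935e62944d6893d135681bc4d28fa69347ec464d1d8a71340cede4cada8b9328e6e44c9b74c132551f84c6fca8931b91cc4c61f9a13139dc84c4bbc9131163ec4c31ee31306e9ea4c17bcc930567b84c0b2fe12ff0c0e4bf205d12f82f264bd675012de11b64b64ccb92d46f2a4b4d36c92d1ee484b38d6592cdda324b267e112c4c7b44afc86392bd52a44aea83b12b72c384ad57c412af59c24ab931d12ac5f1a4a8c57d129fc2644a7751c929db3284a6657c1298e0fe4a5c95e1296da9a4a576711294c9f64a4e3f8129273d64a47f32927d646a49f05f2127acd5249e0d761277956249c35bc92705e7a49be169926d7a3049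a0bed92657786496be62925a9ae4495f0d912506bec49295ee124953f8491c3dd92451e7c490e97b1242b5de48f45ab9239bc3448d9e539232d3d64833ea791f91c5a47ba53191ed1a9647ab45c11e95f20479a83711cd13d6472f33291c5f1b0470cbab91b9de0846d5ed011b34f4446c97e211b1b73246abe3111aa761e46a22fb91a27baa467c2b3119ce274466e9271197e8aa4653b9c119346f8463dc6a918f11ec461fcb191866d9e46178f3917d7a4245eb4b291778b4a45da8d99172e6d045ca16f116e3a9a45b6d94916d393a45ada99116a957845a5f2311686cbe4594d4f1164a8fc458e3ab9162771e4587e539157ba14455cd339155cb58454dd539152ef9045427b7913e52ce44f2aae113af85444e3ace9136b1e444c86df10fee51243f60dc90fcf41843f25b190fbd0d043eec2510f9a5a843bd70390ee49b843b53d810e315bc436db4c10d91c7c435b6b410d4ab9e42dfa2390b78be242d19b710b3ce5442be6c910af769242b7a9a10acfa5842aee4d10a7f4b04209f77907753b041773b1905aec5e4163fcc10589f764149b9f904deae640fe715903f14de40eeea3903acde640e2fb39023cdec3f715a00fd98c923f6581a0fd870583f535280fd3ca123f4e4928fc389683ee91640fb941d03ee15190fb2a2703ec84b90fb1a4a83e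c2d260fa5a2643e5d2858f9538723e486e90f91913c3e22aec0f87544c3df42c18f7929163dd621a0f74985a3dd1c498f73324a3dc9e888f6ea3123d90c978f4d1d523d24ee20f4873e03d1e3070f43aac43ce741c8f31313e3ca2fa88f247b503c906fa8f2339723c84bd98f1d489c3c7174a8f15a9d03c52f198f12b7603bac31c8eea92663ba65898ee8e14c3ba1a710ee722983b9944e0ee533923b933230ee4acc83b8e3948ee2732a3b7a9888ed982ea3aec1d28eb3e4603a2e8970e82be6a39c9d168e5d552a3969c788e55d64639563870e52f28e393d9948e4e9b28390caf58e42d6ac38f9c340e3b24e638eaf280e3932f038d867a8e2fab1238b33638e2cadc838ac1f68e274a5e388f9a50e1d7e0638656370e193bb038519ed0e0f9e84383a3ad8e0bdb323826a9f8e03d73637d83498df5099a37d070b0df3029e37ca88e8df1a16637c2c558de6174a378ae468dd53838374653c0dcf882e372d1178dc7e116371a4670dc5923e36b254d8da83b66369f1268da6643c368b29b0d9f825a36749658d99895e365345b0d907da435e96a88d79d03a35cd1a58d7134f035753548d5c58e435678668d58f42e354e9c60d4ddb8035223ed0d45d634351563b0d3e326834f25698d392cd834d1d3a0d31cd9434b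d7110d2b19f2349917d0d21e9b4347f1940d1f4e2634796e40d1e3b28346db328d1b0fa4346a5f88d18e6ac345c9c70d16d94c34595e58d14abd633e2ca68cd9ce2a33651978cd5e314334f50e8cd0d798333bd880ccce54e3331b710cca5aea33185db0cc2bba432f496c8cba89f232e8e598cb5c69832c9ab60cab6ad232aa5ea0ca72756329b68b0c9f5988326836f8c97543e3243f2d8c8f1af0322d7d10c8a4f76321c5bd0c83bc6e31ec6728c74e634319acba0c63e358313dce18c4e63b6311df8c8c44f2fa310cfec0c2f523c30ac4ef8c275f8a30993ee0c23f1d82f8b5328bd38ca62f346c98bcc534e2f2ac4d8bc875962f205be8bc7e9042efc3188bb612ce2ed67818bb3474a2eb27830bab36842e9a1cd0ba66c2c2e8b1ad8ba1a5ae2e82d670b9e76822e6b6348b9ab8962e5bd288b9695562e586e38b925e3a2e32ae60b7ea2162dd912e8b7437922dcbb888b6e0cda2da69b20b649d962d8cde10b61f3262d7a5150b5c50f42d6aca30b5789d02d4ebc20b4fc1b02d2da538b4a96ac2d2475e0b48e7e22d1f2aa8b46dd842d1543f8b44cee82d0fb1c0b4364f82d07e990b2e1e582c9fa628b24ef502c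8d1f60b1fac602c7c8ae8b188efa2c5cbc38af4aa2e2b669cc8ad92f462b57ac18ad3bd202b437e28acea1742b334970acbf0c62b260fb0ac751b82b0dcea0abe4a702af532a0aba507c2adaa560ab5af822ab78998aa8b3d62a9a35e0aa3dcc82a75e1c8a9d1b1e2a64f710a9465f42a3e7310a8e8cf42a2f65c8a8b365e2a0f55d0a7f560a29f721a8a7cd85829dd6838a76c5aa29d92dc8a74d6c429b6da28a6b69682992aaf8a62755c296fc158a5ae5e029678ce0a53137e28fea850a3f24ce28e23b70a37a7a0287e6d20a1eed902873f260a1bdac8285fc690a17792e2824f9f09f45a9a27bc45609ee88ae27b987489ec12fa27a913789cdd9c2273331d09c977902723b9909c53ba6270657d89be82d826e4ba609b5672826cb2da09b17d2626b0ed309abf23226ae45709a1637c2676c65899b6e8826554fc89938cee262dd39098965ec261cf550983f788260e5f3097d662825eb3a8097792a625d83d909741e6e25c52fa09712bae25b5f11096c69f225af16c096135f4256cf0d09594d7a255a2f50954fa9824fb1b48937b98a24d0df609339f5024b43f3092aa7b824a35bd09285e7c249637b0922abbc241de5708fd496623eb94988fa55b023e54da88f846dc23dee4808eaf91a23aa6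9d08e99e3623a5dd288e3e52c2381adf88df09762375e0e08da5cf02360b6f08d671ce2355d6388be394e22f6c6c08bc4eae22e47c788b8e3d622db6ca88b6bc8e22d6e9508b532de22ca7a788b270fe22c7f0d087b8dc821b5c8f886933bc219f8dc08657f882191bee885eea38217a29f085d66f22173e5508547b76209fc7c0819e6f41fa38b487dea2a21f6825d07d987261f4bac487cf1b421f35a1a07cc785a1f2d6b007ca4e381f28b5587c92b8c1ee529907ac5c9a1eafd0407a70d361e9ab6487a51e5a1e902fb879c9b521e6cca5879a47981e650f607966b141e435b507905e5e1e19d53077271941da3fa08764d78a1d92dcc0763f5121d85bd1875f21aa1d7422f075a742c1d5e8b10752f7401d1ee2a0746ad1c1d12f9c074316fa1cb952e872dd8721cae33307299dc41c9d24f0724c5f61c699ab0719ea641c5f46c87145d781c3ba9c070e62f81c37b2a870c9b3e1c273ae06f3294e1b7905b06d965a61b52cd386d397861b46fa486cdb3441b238bd86c6dc5a1b0e37a06bf14681afa30b86be60d41af409f86b609ec1a9fb1886a762b81a967d206a573b01a8af7406a0cef81a77662869ccc3c1a58f4d869195bc1a366bc868abe381a277d18688cf741a165bd067d569019f43b2867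afc8219de92c86758da419d40df066ea4b819b4aba866b1c74199ee23066436dc198e795865e3c36196db61065a7a54196463f06586b5e195c8f50656dcc8195555e8654af1e194be4e0652997c1947ea6063d7c0e18f1a6e0639d69418d67c90634eb9a18c4d6f05fe511817ec0b385f9738217c87d285ee4a3817b165585eae46817a3dc105e708f8173bca805ce91cc172adc505c463ee16f889b85b89f5016d34d905b26e5816c776405afc4ca16b6d0d85ac4bd616af87185ab6e5016a7caa05a992ee16955f805a4aeae168e23f05a363e61687e6c859e2b2e166fd118599876e164ddca057f8b0415eea45857b46c615ec96a0577e0a415dda0b05734b7215b760e056d56e015a236f0565d58c157bc46855e9276156b5f08554637e153dd92854eed241537a59054bdcd0152ef2505477a4e14f6d2905391e3e14db6d1853271de1412eef84fd63c213eb27484fa27b013de4e184f22bb413c697904f0b5d613b2ea684ea657813969ab84e3794c137d0da84dafc461363bca04d21f6e12f71b284b7ba3212dcd3a04b09ef812715f3049875de125a9dd84954bf81254aef0492e6f4122ef0f047ce66411bdc63846e61bc119e4fa84677c3a118cf6e8445d3fa10ef56a8437999c10d27770433bf4610ccdf3841bdcea0fe46a683f8e4c80fd549983f4a94c0fce26c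83f274340faa26e03e576440f63b6203d712740f1cd9503bc64cc0ece6cc83aa9b380e71b63837b12b80dd3b51833e51760ce5dc9832e75540c9f88f03276ce40c9399f03234ef40c6cdcd8317f46a0c5deac83147ef00c4f59e82f99b880bd991d02eea2ce0b8bbd202ceab8c0b3731782ccd9ea0b2637702c4d5ec0ab7a7482acfc640aa2f7902a66f4e0a97975027b93aa09bb9b1826d6c5c09b1e7a02692dde0991d7b024eef8408f59d98237f44c08ddea502347ed408cf597021f277607f227301f37630077c32e01d59f9207327e681cbdaa6072ee7201c9cbac070cefa019f1e38066f467819bb2f206668fe019353bc05f3371015bda36056ee560159cb3e055e5ec01533b78053a5ee813f537004dec8f01373ce404d2d9f81331ef404bddd400f7667003b7a6680ecfc2c03ab3f280e8bdae039796780df8da8036b66700dabaf00362afe80d25bbe02b93f3009f9f2a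

/-- The entries of the orbit table. -/
def entry (n : ℕ) : ℕ := Nat.land (Nat.shiftRight orbitTable (Nat.mul 30 n)) 0x3fffffff

/-- Binary search in the orbit table. -/
def search (c f : ℕ) : ℕ → ℕ → ℕ :=
  Nat.rec (fun lo _ => lo)
    (fun _ ih lo hi => cond (Nat.ble (entry (Nat.div (Nat.add lo hi) 2)) c)
      (ih (Nat.div (Nat.add lo hi) 2) hi) (ih lo (Nat.div (Nat.add lo hi) 2))) f

/-- Whether the `n`-th entry is `c`, and describes the list `l`. -/
def entryIs (c : ℕ) (l : List ℕ) (n : ℕ) : Bool :=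
  cond (Nat.blt n 3024)
    (cond (Nat.beq (entry n) c) (eqList l (bits (Nat.div c 4) 28)) false) false

/-- Whether the image of the entry `c` is an entry. -/
def staysInTable (T E c : ℕ) : Bool :=
  actList T E (bits (Nat.div c 4) 28) fun l s =>
    (fun c' => entryIs c' l (search c' 12 0 3024))
      (Nat.add (Nat.mul 4 (ofBits l)) (Nat.mod (Nat.add c s) 4))

/-- Whether `p` holds for the first `n` entries of the table. -/
def allEntries (p : ℕ → Bool) (n : ℕ) : Bool :=
  Nat.rec true (fun n ih => cond (p (entry n)) ih false) n

lemma of_allEntries {p : ℕ → Bool} {n : ℕ} (h : allEntries p n = true) :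
    ∀ a < n, p (entry a) = true := by
  induction n with
  | zero => exact fun a ha => absurd ha (Nat.not_lt_zero a)
  | succ n ih =>
    change cond (p (entry n)) (allEntries p n) false = true at h
    cases hp : p (entry n) with
    | false => rw [hp] at h; exact absurd h Bool.false_ne_true
    | true =>
      rw [hp, cond_true] at h
      intro a ha
      rcases Nat.lt_succ_iff_lt_or_eq.1 ha with h1 | rfl
      · exact ih h a h1
      · exact hp

/-- The vector described by an entry of the table. -/
def entryVec (c : ℕ) : ExteriorAlgebra ℂ R28 :=
  Complex.I ^ (c % 4) • listWedge (bits (c / 4) 28)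

/-- The vectors described by the table. -/
def tableVecs : Set (ExteriorAlgebra ℂ R28) := (fun n => entryVec (entry n)) '' Set.Iio 3024

/-- Correctness of the binary search is not needed, nor that the table is sorted: `entryIs` checks
that the entry found is the right one. Twelve halvings suffice as `3024 < 2 ^ 12`. -/
lemma map_mem_tableVecs {T E : ℕ} {g : R28 ≃ₗ[ℂ] R28} (hg : Describes T E g)
    (h : allEntries (staysInTable T E) 3024 = true) :
    Set.MapsTo (ExteriorAlgebra.map (g : R28 →ₗ[ℂ] R28)) tableVecs tableVecs := by
  rintro _ ⟨n, hn, rfl⟩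
  have h1 := of_allEntries h n hn
  obtain ⟨l, s, h2, h3⟩ := actList_spec hg (bits (entry n / 4) 28) fun a ha => (mem_bits.1 ha).1
  -- An entry is congruent to its exponent modulo `4`, so it can be added to `s` without extracting
  -- the exponent.
  set c' := 4 * ofBits l + (entry n + s) % 4 with hc'
  change actList T E (bits (entry n / 4) 28) (fun l s => _) = true at h1
  rw [h2] at h1
  change entryIs c' l (search c' 12 0 3024) = true at h1
  simp only [entryIs, Bool.cond_eq_ite, Bool.if_false_right, Bool.and_eq_true, decide_eq_true_eq]
    at h1
  obtain ⟨h4, h5, h6⟩ := h1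
  refine ⟨_, Nat.blt_eq.mp h4, ?_⟩
  have h7 : c' % 4 = (entry n + s) % 4 := by omega
  change entryVec (entry (search c' 12 0 3024))
    = ExteriorAlgebra.map (g : R28 →ₗ[ℂ] R28) (entryVec (entry n))
  rw [Nat.eq_of_beq_eq_true h5, entryVec, h7, I_pow_mod, entryVec, map_smul, h3, smul_smul,
    I_pow_mod, ← pow_add, eq_of_eqList h6]
  rfl

lemma map_exteriorAlgebra_injective (g : R28 ≃ₗ[ℂ] R28) :
    Function.Injective (ExteriorAlgebra.map (g : R28 →ₗ[ℂ] R28)) := by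
  refine Function.LeftInverse.injective
    (g := ExteriorAlgebra.map (g.symm : R28 →ₗ[ℂ] R28)) fun x => ?_
  rw [← AlgHom.comp_apply, ExteriorAlgebra.map_comp_map]
  have : (g.symm : R28 →ₗ[ℂ] R28) ∘ₗ (g : R28 →ₗ[ℂ] R28) = LinearMap.id := by ext; simp
  rw [this, ExteriorAlgebra.map_id]; rfl

/-- The transformations permuting the vectors described by the table. -/
def tableStabilizer : Subgroup (R28 ≃ₗ[ℂ] R28) where
  carrier := {g | ExteriorAlgebra.map (g : R28 →ₗ[ℂ] R28) '' tableVecs = tableVecs}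
  one_mem' := by
    change ExteriorAlgebra.map LinearMap.id '' tableVecs = tableVecs
    rw [ExteriorAlgebra.map_id]
    exact Set.image_id _
  mul_mem' {g h} hg hh := by
    change ExteriorAlgebra.map ((g : R28 →ₗ[ℂ] R28) ∘ₗ (h : R28 →ₗ[ℂ] R28)) '' tableVecs = tableVecs
    rw [← ExteriorAlgebra.map_comp_map, AlgHom.coe_comp, Set.image_comp, hh, hg]
  inv_mem' {g} hg := by
    change ExteriorAlgebra.map (g.symm : R28 →ₗ[ℂ] R28) '' tableVecs = tableVecs
    nth_rewrite 1 [← hg]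
    have : (g.symm : R28 →ₗ[ℂ] R28) ∘ₗ (g : R28 →ₗ[ℂ] R28) = LinearMap.id := by ext; simp
    rw [← Set.image_comp, ← AlgHom.coe_comp, ExteriorAlgebra.map_comp_map, this,
      ExteriorAlgebra.map_id]
    exact Set.image_id _

/-- An injective map of a finite set into itself is onto, so checking one inclusion is enough. -/
lemma mem_tableStabilizer {T E : ℕ} {g : R28 ≃ₗ[ℂ] R28} (hg : Describes T E g)
    (h : allEntries (staysInTable T E) 3024 = true) : g ∈ tableStabilizer := by
  have hfin : tableVecs.Finite := (Set.finite_Iio 3024).image _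
  exact Set.eq_of_subset_of_ncard_le (map_mem_tableVecs hg h).image_subset
    (Set.ncard_image_of_injective _ (map_exteriorAlgebra_injective g)).ge hfin

/-- Three generators of the monomial group, with their descriptions. -/
def threeGens : Fin 3 → R28 ≃ₗ[ℂ] R28 :=
  ![coordPerm permV, monomial (fun _ => 1) permN356, monomial expM permM]

def threeImages : Fin 3 → ℕ := ![0xdc1f1735895a8e64148300839c6af6aca93, 0xd9483d670b52693939ac41cd183c4105ed5, 0x646d8a647754b474b5db14de581901aac80]
def threeExps : Fin 3 → ℕ := ![0, 0x55555555555555, 0x94f14f02f14f14]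

lemma describes_threeGens (x : Fin 3) : Describes (threeImages x) (threeExps x) (threeGens x) := by
  fin_cases x
  · exact describes_permV
  · exact describes_permN356
  · exact describes_permM

lemma staysInTable_permV : allEntries (staysInTable 0xdc1f1735895a8e64148300839c6af6aca93 0) 3024 = true := by
  decide +kernel

lemma staysInTable_permN356 : allEntries (staysInTable 0xd9483d670b52693939ac41cd183c4105ed5
    0x55555555555555) 3024 = true := by
  decide +kernel

lemma staysInTable_permM : allEntries (staysInTable 0x646d8a647754b474b5db14de581901aac80
    0x94f14f02f14f14) 3024 = true := by
  decide +kernel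

lemma threeGens_mem (x : Fin 3) : threeGens x ∈ tableStabilizer := by
  fin_cases x
  · exact mem_tableStabilizer describes_permV staysInTable_permV
  · exact mem_tableStabilizer describes_permN356 staysInTable_permN356
  · exact mem_tableStabilizer describes_permM staysInTable_permM

/-- The image index and exponent of a basis vector under a word in the three generators. -/
def runWord (w : List (Fin 3)) (a : ℕ) : ℕ × ℕ :=
  w.foldr (fun x r => (digit32 (threeImages x) r.1,
    r.2 + digit4 (threeExps x) (digit32 (threeImages x) r.1))) (a, 0)

lemma prod_word_eb (w : List (Fin 3)) (a : ℕ) (ha : a < 28) : (runWord w a).1 < 28 ∧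
    (w.map threeGens).prod (eb a) = Complex.I ^ (runWord w a).2 • eb (runWord w a).1 := by
  induction w with
  | nil => exact ⟨ha, by simp [runWord]⟩
  | cons x w ih =>
    obtain ⟨h1, h2⟩ := ih
    obtain ⟨h3, h4⟩ := describes_threeGens x _ h1
    refine ⟨h3, ?_⟩
    rw [List.map_cons, List.prod_cons, LinearEquiv.mul_apply, h2, map_smul, h4, smul_smul,
      ← pow_add]
    rfl

/-- A criterion for a monomial transformation to be equal to a word in the three generators. -/
lemma monomial_mem_tableStabilizer (w : List (Fin 3)) {k : Fin 28 → ℕ} {σ : Equiv.Perm (Fin 28)}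
    (h : ∀ i : Fin 28, (σ i : ℕ) = (runWord w i).1 ∧ k (σ i) % 4 = (runWord w i).2 % 4) :
    monomial k σ ∈ tableStabilizer := by
  have heq : monomial k σ = (w.map threeGens).prod := by
    refine LinearEquiv.toLinearMap_injective ((Pi.basisFun ℂ (Fin 28)).ext fun i => ?_)
    obtain ⟨h1, h2⟩ := h i
    rw [Pi.basisFun_apply]
    change monomial k σ (Pi.single i 1) = (w.map threeGens).prod (Pi.single i 1)
    rw [← eb_val i, (prod_word_eb w i i.isLt).2, ← h1, eb_val, eb_val, monomial_single,
      ← I_pow_mod, h2, I_pow_mod]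
  rw [heq]
  refine Subgroup.list_prod_mem _ fun g hg => ?_
  obtain ⟨x, -, rfl⟩ := List.mem_map.1 hg
  exact threeGens_mem x

/-- The table is checked only for `V`, `i N_{356}` and `m`. Every other generator is written as a
word in these, with letters `0`, `1`, `2` in this order and the rightmost letter acting first. -/
lemma monomialGroup_le : monomialGroup ≤ tableStabilizer := by
  refine (Subgroup.closure_le _).2 ?_
  rintro g (⟨D, hD, rfl⟩ | hg)
  · simp only [dozens, List.mem_cons, List.not_mem_nil, or_false] at hD
    rcases hD with rfl | rfl | rfl | rfl | rfl | rfl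
    · exact monomial_mem_tableStabilizer
        [2, 1, 2, 1] (by decide +kernel)
    · exact monomial_mem_tableStabilizer
        [1, 0, 2, 0, 2, 0, 1, 0, 1, 2, 1, 0, 1, 2, 1, 0] (by decide +kernel)
    · exact monomial_mem_tableStabilizer
        [2, 0, 2, 0, 2, 0] (by decide +kernel)
    · exact monomial_mem_tableStabilizer
        [2, 0, 2, 1, 0, 1, 2, 1, 0, 2, 0, 1, 0, 0, 2] (by decide +kernel)
    · exact monomial_mem_tableStabilizer
        [1, 0, 2, 0, 2, 0, 1, 0, 1, 2, 1, 0, 2, 0] (by decide +kernel)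
    · exact monomial_mem_tableStabilizer
        [1, 0, 0, 1, 2, 0, 2, 0, 2, 0, 1, 0, 0, 1] (by decide +kernel)
  · simp only [Set.mem_insert_iff, Set.mem_singleton_iff] at hg
    rcases hg with rfl | rfl | rfl | rfl | rfl | rfl | rfl
    · exact monomial_mem_tableStabilizer
        [2, 1, 2, 1, 0, 2, 1, 2, 1, 0, 2, 1, 2, 1, 0] (by decide +kernel)
    · exact monomial_mem_tableStabilizer [1, 0, 1, 0, 0, 1, 0, 1, 0, 0] (by decide +kernel)
    · exact monomial_mem_tableStabilizer
        [0, 1, 2, 0, 1, 0, 2, 1, 0, 1, 0, 1, 2, 0, 0, 1, 0, 2, 1, 1, 0] (by decide +kernel)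
    · exact threeGens_mem 1
    · exact monomial_mem_tableStabilizer
        [2, 1, 0, 2, 1, 2, 0, 1, 2, 0, 2, 1, 2, 1, 1, 0, 2, 0, 1, 0, 1, 0, 1] (by decide +kernel)
    · exact threeGens_mem 0
    · exact threeGens_mem 2

/-! ### The coefficient of `ϱ` at the second representative. -/

/-- The binary encodings of the representatives and of their complements. -/
def repCodes : List ℕ :=
  [255722676, 12712779, 135477998, 132957457, 140571130, 127864325,
    86637105, 181798350, 245239557, 23195898, 220007365, 48428090,
    20312126, 248123329, 135405531, 133029924, 247091880, 21343575,
    54861772, 213573683, 145283383, 123152072, 145251701, 123183754,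
    145582389, 122853066, 145290355, 123145100, 134608215, 133827240,
    125311641, 143123814, 110564149, 157871306, 259672712, 8762743,
    68498909, 199936546, 232251776, 36183679, 242213248, 26222207,
    213901696, 54533759, 259957120, 8478335, 232763648, 35671807,
    259453184, 8982271, 117371136, 151064319, 265187712, 3247743,
    184447360, 83988095, 125751680, 142683775, 131852544, 136582911,
    58714368, 209721087, 251611392, 16824063, 133802368, 134633087,
    261941632, 6493823]

/-- The binary encodings of all these sets except the second representative. -/
def otherCodes : List ℕ := repCodes.eraseIdx 2

def notElem (m : ℕ) (l : List ℕ) : Bool :=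
  List.rec true (fun x _ ih => cond (Nat.beq x m) false ih) l

lemma notMem_of_notElem {m : ℕ} {l : List ℕ} (h : notElem m l = true) : m ∉ l := by
  induction l with
  | nil => exact List.not_mem_nil
  | cons x l ih =>
    change cond (Nat.beq x m) false (notElem m l) = true at h
    cases hx : Nat.beq x m with
    | true => rw [hx] at h; exact absurd h Bool.false_ne_true
    | false =>
      rw [hx, cond_false] at h
      rw [List.mem_cons, not_or]
      exact ⟨fun e => by rw [e] at hx; simp at hx, ih h⟩

/-- The entry encodes a `14`-element set different from the other representatives; if it encodes
the second representative, the exponent is zero. -/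
def goodEntry (c : ℕ) : Bool :=
  cond (Nat.beq (List.length (bits (Nat.div c 4) 28)) 14)
    (cond (notElem (Nat.div c 4) otherCodes)
      (cond (Nat.beq (Nat.div c 4) 135477998) (Nat.beq (Nat.mod c 4) 0) true) false) false

lemma goodEntry_all : allEntries goodEntry 3024 = true := by
  decide +kernel

lemma bit_eq_testBit (m a : ℕ) : bit m a = Nat.testBit m a := by
  rw [Bool.eq_iff_iff, Nat.testBit_eq_decide_div_mod_eq, decide_eq_true_eq]
  change Nat.beq ((m >>> a) &&& 1) 1 = true ↔ _
  rw [Nat.beq_eq, Nat.and_one_is_mod, Nat.shiftRight_eq_div_pow]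

lemma bitSet_injective {m m' : ℕ} (hm : m < 2 ^ 28) (hm' : m' < 2 ^ 28)
    (h : bitSet m = bitSet m') : m = m' := by
  refine Nat.eq_of_testBit_eq fun a => ?_
  by_cases ha : a < 28
  · have h1 := Finset.ext_iff.1 h ⟨a, ha⟩
    simp only [bitSet, Finset.mem_filter, Finset.mem_univ, true_and, bit_eq_testBit] at h1
    exact Bool.eq_iff_iff.2 h1
  · have h2 : 2 ^ 28 ≤ 2 ^ a := Nat.pow_le_pow_right (by norm_num) (not_lt.1 ha)
    rw [Nat.testBit_lt_two_pow (hm.trans_le h2), Nat.testBit_lt_two_pow (hm'.trans_le h2)]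

lemma card_bitSet (m : ℕ) : (bitSet m).card = (bits m 28).length := by
  have h : (bitSet m).map Fin.valEmbedding = (bits m 28).toFinset := by
    ext a
    simp only [Finset.mem_map, bitSet, Finset.mem_filter, Finset.mem_univ, true_and,
      List.mem_toFinset, mem_bits, Fin.valEmbedding_apply]
    exact ⟨fun ⟨i, hi, hia⟩ => hia ▸ ⟨i.isLt, hi⟩, fun ⟨h1, h2⟩ => ⟨⟨a, h1⟩, h2, rfl⟩⟩
  rw [← Finset.card_map Fin.valEmbedding, h,
    List.toFinset_card_of_nodup ((pairwise_bits m 28).imp fun h => h.ne')]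

lemma entry_div_lt (n : ℕ) : entry n / 4 < 2 ^ 28 := by
  have h : entry n ≤ 0x3fffffff := Nat.and_le_right
  omega

lemma goodEntry_spec {n : ℕ} (hn : n < 3024) : (bits (entry n / 4) 28).length = 14 ∧
    entry n / 4 ∉ otherCodes ∧ (entry n / 4 = 135477998 → entry n % 4 = 0) := by
  have h := of_allEntries goodEntry_all n hn
  change cond (Nat.beq (List.length (bits (entry n / 4) 28)) 14)
    (cond (notElem (entry n / 4) otherCodes)
      (cond (Nat.beq (entry n / 4) 135477998) (Nat.beq (entry n % 4) 0) true) false) false = true at h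
  rw [Bool.cond_eq_ite, Bool.cond_eq_ite, Bool.cond_eq_ite] at h
  split_ifs at h with h1 h2 h3
  · exact ⟨Nat.eq_of_beq_eq_true h1, notMem_of_notElem h2, fun _ => Nat.eq_of_beq_eq_true h⟩
  · exact ⟨Nat.eq_of_beq_eq_true h1, notMem_of_notElem h2, fun e => absurd (Nat.beq_eq.mpr e) h3⟩

lemma coe_repCodes (k : Fin 34) : (rep k : Finset (Fin 28)) = bitSet (repCodes.getD (2 * k) 0) ∧
    (repCompl k : Finset (Fin 28)) = bitSet (repCodes.getD (2 * k + 1) 0) := by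
  revert k; decide +kernel

lemma repCodes_lt : ∀ m ∈ repCodes, m < 2 ^ 28 := by decide

lemma getD_mem_otherCodes (k : Fin 34) : (k ≠ 1 → repCodes.getD (2 * k) 0 ∈ otherCodes) ∧
    repCodes.getD (2 * k + 1) 0 ∈ otherCodes := by
  revert k; decide +kernel

lemma coe_wedge_rep_mem : (wedge (rep 1) : ExteriorAlgebra ℂ R28) ∈ tableVecs := by
  -- The position of the second representative, with exponent zero, in the table.
  refine ⟨1524, by simp, ?_⟩
  have h : entry 1524 = 4 * 135477998 := by decide +kernel
  have h1 : (rep 1 : Finset (Fin 28)) = bitSet 135477998 := (coe_repCodes 1).1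
  rw [coe_wedge h1]
  change entryVec (entry 1524) = _
  rw [h, entryVec, Nat.mul_mod_right, Nat.mul_div_cancel_left _ (by norm_num), pow_zero, one_smul]

/-- Multiples of basis vectors in the orbit of the second representative come from the table. -/
lemma exists_entry_of_mem_wedgeOrbit {c : ℂ} (hc : c ≠ 0) {J : Set.powersetCard (Fin 28) 14}
    (h : c • wedge J ∈ wedgeOrbit (rep 1)) :
    ∃ n < 3024, (J : Finset (Fin 28)) = bitSet (entry n / 4) ∧ c = Complex.I ^ (entry n % 4) := by
  obtain ⟨g, hg, hgJ⟩ := h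
  -- Only the inclusion of the orbit in the table is used, and it follows from stability since the
  -- table contains `a_I`.
  have h1 : ((c • wedge J : Ext14) : ExteriorAlgebra ℂ R28) ∈ tableVecs := by
    have hs : ExteriorAlgebra.map (g : R28 →ₗ[ℂ] R28) '' tableVecs = tableVecs :=
      monomialGroup_le hg
    rw [hgJ, coe_map_wedge, ← hs]
    exact Set.mem_image_of_mem _ coe_wedge_rep_mem
  obtain ⟨n, hn, h2⟩ := h1
  refine ⟨n, hn, ?_⟩
  let K : Set.powersetCard (Fin 28) 14 := ⟨bitSet (entry n / 4), by
    rw [Set.powersetCard.mem_iff, card_bitSet]; exact (goodEntry_spec hn).1⟩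
  have h3 : c • wedge J = Complex.I ^ (entry n % 4) • wedge K := Subtype.ext (by
    rw [← h2, Submodule.coe_smul, coe_wedge (K := K) rfl]; rfl)
  obtain ⟨rfl, h4⟩ := smul_wedge_injective hc h3
  exact ⟨rfl, h4⟩

lemma gam_rep_self : gam (rep 1) (rep 1) = 1 := by
  rw [gam, Finset.sum_eq_single 0]
  · rw [if_pos]
    · simp
    · exact ⟨1, one_mem _, by
        change _ = exteriorPower.map 14 LinearMap.id _
        rw [exteriorPower.map_id]; simp⟩
  · intro k _ hk
    refine if_neg fun h => hk ?_
    obtain ⟨n, hn, h1, h2⟩ := exists_entry_of_mem_wedgeOrbit (pow_ne_zero _ Complex.I_ne_zero) h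
    have h3 : (rep 1 : Finset (Fin 28)) = bitSet 135477998 := (coe_repCodes 1).1
    have h4 := bitSet_injective (entry_div_lt n) (by norm_num) (h1.symm.trans h3)
    rw [(goodEntry_spec hn).2.2 h4] at h2
    exact I_pow_fin_injective (l := 0) h2
  · simp

/-- If the orbit of `a_J` contained a multiple of the second representative, the inverse group
element would place a multiple of `a_J` in the table, which omits all the other codes. -/
lemma gam_eq_zero {J : Set.powersetCard (Fin 28) 14} {m : ℕ} (hm : m ∈ otherCodes)
    (hJ : (J : Finset (Fin 28)) = bitSet m) : gam J (rep 1) = 0 := by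
  refine Finset.sum_eq_zero fun k _ => if_neg ?_
  rintro ⟨g, hg, h⟩
  have hI : Complex.I ^ (k : ℕ) ≠ 0 := pow_ne_zero _ Complex.I_ne_zero
  have h1 : (Complex.I ^ (k : ℕ))⁻¹ • wedge J ∈ wedgeOrbit (rep 1) := by
    refine ⟨g⁻¹, inv_mem hg, ?_⟩
    rw [inv_smul_eq_iff₀ hI, ← map_smul, h, ← LinearMap.comp_apply, ← exteriorPower.map_comp]
    have : (g.symm : R28 →ₗ[ℂ] R28) ∘ₗ (g : R28 →ₗ[ℂ] R28) = LinearMap.id := by ext; simp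
    change _ = exteriorPower.map 14 ((g.symm : R28 →ₗ[ℂ] R28) ∘ₗ (g : R28 →ₗ[ℂ] R28)) _
    rw [this, exteriorPower.map_id, LinearMap.id_apply]
  obtain ⟨n, hn, h2, -⟩ := exists_entry_of_mem_wedgeOrbit (inv_ne_zero hI) h1
  have h3 := bitSet_injective (entry_div_lt n)
    (repCodes_lt m (List.mem_of_mem_eraseIdx hm)) (h2.symm.trans hJ)
  exact (goodEntry_spec hn).2.1 (h3 ▸ hm)

lemma repr_orbitInvariant (I K : Set.powersetCard (Fin 28) 14) :
    (extBasis (Fin 28) 14).repr (orbitInvariant I) K = gam I K := by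
  simp only [orbitInvariant, wedge_eq, map_sum, map_smul, Basis.repr_self,
    Finsupp.finsetSum_apply, Finsupp.smul_apply, Finsupp.single_apply, smul_eq_mul, mul_ite,
    mul_one, mul_zero, Finset.sum_ite_eq', Finset.mem_univ, if_true]

/-- Of the 68 orbit sums in `ϱ`, only that of the second representative has a nonzero coordinate
there, namely `1`. No cancellation is possible. -/
lemma coeffRho_rep : coeffRho (rep 1) ≠ 0 := by
  have h : coeffRho (rep 1)
      = (1 / (Real.sqrt 86272 : ℂ)) * (((rhoTable 1).2.1 : GaussianInt) : ℂ) := by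
    rw [coeffRho, rho, map_smul, Finsupp.smul_apply, smul_eq_mul, map_sum,
      Finsupp.finsetSum_apply, Finset.sum_eq_single 1]
    · rw [map_add, map_smul, map_smul, Finsupp.add_apply, Finsupp.smul_apply, Finsupp.smul_apply,
        repr_orbitInvariant, repr_orbitInvariant, gam_rep_self,
        gam_eq_zero (getD_mem_otherCodes 1).2 (coe_repCodes 1).2]
      simp
    · intro k _ hk
      rw [map_add, map_smul, map_smul, Finsupp.add_apply, Finsupp.smul_apply, Finsupp.smul_apply,
        repr_orbitInvariant, repr_orbitInvariant,
        gam_eq_zero ((getD_mem_otherCodes k).1 hk) (coe_repCodes k).1,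
        gam_eq_zero (getD_mem_otherCodes k).2 (coe_repCodes k).2]
      simp
    · simp
  have h1 : (rhoTable 1).2.1 ≠ 0 := by decide
  rw [h]
  refine mul_ne_zero (one_div_ne_zero ?_) ?_
  · rw [Complex.ofReal_ne_zero, Real.sqrt_ne_zero']
    norm_num
  · rwa [Ne, GaussianInt.toComplex_eq_zero]

end Rudvalis
end

theorem mainTheorem3 : Finite Rudvalis.groupF :=
  Rudvalis.finite_groupF_of_coeffRho Rudvalis.coeffRho_evenNeighbour Rudvalis.coeffRho_rep
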